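/- Let $n\ge 0$ and $\mathbb T^n=(\mathbb R/\mathbb Z)^n$ with its normalised Haar measure $dw$; $\mathbb Z^n$ carries counting measure. For $m\in\mathbb Z^n$, $w\in\mathbb T^n$ put $M_wT_mg(k)=e^{2\pi i w\cdot k}g(k-m)$ and $V_gf(m,w)=\sum_{k\in\mathbb Z^n}f(k)\overline{g(k-m)}e^{-2\pi i w\cdot k}$. Similarly, on $\mathbb Z^n\times\mathbb T^n$ put $V_\Phi\sigma\big((m,x),(\xi,j)\big)=\langle\sigma,M_{(\xi,j)}T_{(m,x)}\Phi\rangle$ for $(m,x)\in\mathbb Z^n\times\mathbb T^n$ and $(\xi,j)\in\mathbb T^n\times\mathbb Z^n$, where $M_{(\xi,j)}T_{(m,x)}\Phi(m',w')=e^{2\pi i(\xi\cdot m'+j\cdot w')}\Phi(m'-m,w'-x)$. Fix non-zero Schwartz windows $\gamma\in\mathcal S(\mathbb Z^n)$ and $\Phi\in\mathcal S(\mathbb Z^n\times\mathbb T^n)$. Let $M^q(\mathbb Z^n)$ be the space of tempered distributions $f\in\mathcal S'(\mathbb Z^n)$ (which are functions on $\mathbb Z^n$) with $\|f\|_{M^q}:=\|V_\gamma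 f\|_{L^q(\mathbb Z^n\times\mathbb T^n)}<\infty$, and let $M^p(\mathbb Z^n\times\mathbb T^n)$ be the space of tempered distributions $\sigma\in\mathcal S'(\mathbb Z^n\times\mathbb T^n)$ with $\|\sigma\|_{M^p}:=\|V_\Phi\sigma\|_{L^p((\mathbb Z^n\times\mathbb T^n)\times(\mathbb T^n\times\mathbb Z^n))}<\infty$. For $g_1,g_2\in M^1(\mathbb Z^n)$ the localization operator with symbol $\sigma$ is $$\mathfrak L_\sigma^{g_1,g_2}f(k)=\sum_{m\in\mathbb Z^n}\int_{\mathbb T^n}\sigma(m,w)\,V_{g_1}f(m,w)\,M_wT_mg_2(k)\,dw,\qquad k\in\mathbb Z^n,$$ where for a distribution $\sigma$ the right-hand side denotes the duality pairing of $\sigma$ with the function $H(m,w)=V_{g_1}f(m,w)M_wT_mg_2(k)$, that is, $\sum_{m,j\in\mathbb Z^n}\sigma(\delta_m\otimes e^{2\pi i j\cdot})\int_{\mathbb T^n}H(m,w)e^{-2\pi i j\cdot w}\,dw$. **Theorem.** There is a constant $C>0$, depending only on $n$ and the windows $\gamma,\Phi$, such that for all $1\le p\le\infty$, $1\le q\le\infty$,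 all $\sigma\in M^p(\mathbb Z^n\times\mathbb T^n)$ and all $g_1,g_2\in M^1(\mathbb Z^n)$: the series defining $\mathfrak L_\sigma^{g_1,g_2}f(k)$ converge absolutely for all $f\in M^q(\mathbb Z^n)$ and $k\in\mathbb Z^n$, the pairing is the integral displayed above if $\sigma$ is given by a function in $L^1(\mathbb Z^n\times\mathbb T^n)\cup L^\infty(\mathbb Z^n\times\mathbb T^n)$, and $\mathfrak L_\sigma^{g_1,g_2}$ is a bounded linear operator from $M^q(\mathbb Z^n)$ to itself with $$\|\mathfrak L_\sigma^{g_1,g_2}f\|_{M^q(\mathbb Z^n)}\le C\,\|\sigma\|_{M^p(\mathbb Z^n\times\mathbb T^n)}\,\|g_1\|_{M^1(\mathbb Z^n)}\,\|g_2\|_{M^1(\mathbb Z^n)}\,\|f\|_{M^q(\mathbb Z^n)}\qquad(f\in M^q(\mathbb Z^n)).$$ For the standard windows $\gamma=\delta_0$ and $\Phi=\delta_0\otimes 1$ one has $C=1$. -/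

import Mathlib

open MeasureTheory Set
open scoped ENNReal ContDiff ComplexConjugate

noncomputable section

namespace LocOp

/-- The lattice `ℤⁿ`. -/
abbrev Zn (n : ℕ) : Type := Fin n → ℤ

/-- The torus `𝕋ⁿ = (ℝ/ℤ)ⁿ`. -/
abbrev Tn (n : ℕ) : Type := UnitAddTorus (Fin n)

/-- The normalised Haar measure on `𝕋ⁿ`. -/
def haarT (n : ℕ) : Measure (Tn n) :=
  Measure.pi fun _ => (AddCircle.haarAddCircle : Measure UnitAddCircle)

/-- The character `e^{2πi k·w}`, for `k ∈ ℤⁿ` and `w ∈ 𝕋ⁿ`. -/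
def chi {n : ℕ} (k : Zn n) (w : Tn n) : ℂ := UnitAddTorus.mFourier k w

/-! ### Schwartz functions and tempered distributions on `ℤⁿ` -/

/-- The Schwartz space `𝓢(ℤⁿ)` of rapidly decreasing functions. -/
def schwartzZ (n : ℕ) : Submodule ℂ (Zn n → ℂ) where
  carrier := {g | ∀ N : ℕ, ∃ C : ℝ, ∀ k, (1 + ‖k‖) ^ N * ‖g k‖ ≤ C}
  zero_mem' := fun N => ⟨0, fun k => by simp⟩
  add_mem' := by
    intro a b ha hb N
    obtain ⟨A, hA⟩ := ha N
    obtain ⟨B, hB⟩ := hb N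
    refine ⟨A + B, fun k => ?_⟩
    calc (1 + ‖k‖) ^ N * ‖(a + b) k‖ ≤ (1 + ‖k‖) ^ N * (‖a k‖ + ‖b k‖) := by
          gcongr
          exact norm_add_le _ _
      _ ≤ A + B := by rw [mul_add]; exact add_le_add (hA k) (hB k)
  smul_mem' := by
    intro c a ha N
    obtain ⟨A, hA⟩ := ha N
    refine ⟨‖c‖ * A, fun k => ?_⟩
    calc (1 + ‖k‖) ^ N * ‖(c • a) k‖ = ‖c‖ * ((1 + ‖k‖) ^ N * ‖a k‖) := by
          simp only [Pi.smul_apply, norm_smul]; ring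
      _ ≤ ‖c‖ * A := by gcongr; exact hA k

/-- The space `𝓢'(ℤⁿ)` of tempered distributions: the linear functionals on `𝓢(ℤⁿ)` which are
continuous, i.e. bounded by a multiple of one of the (increasing) seminorms
`p_N(φ) = sup_k (1 + |k|)^N |φ(k)|`. -/
def temperedZ (n : ℕ) : Submodule ℂ (Module.Dual ℂ (schwartzZ n)) where
  carrier := {u | ∃ (N : ℕ) (C : ℝ), ∀ (φ : schwartzZ n) (B : ℝ),
    (∀ k, (1 + ‖k‖) ^ N * ‖φ.1 k‖ ≤ B) → ‖u φ‖ ≤ C * B}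
  zero_mem' := ⟨0, 0, fun φ B _ => by simp⟩
  add_mem' := by
    rintro a b ⟨N, C, h⟩ ⟨N', C', h'⟩
    refine ⟨N + N', C + C', fun φ B hB => ?_⟩
    have key : ∀ M, M ≤ N + N' → ∀ k, (1 + ‖k‖) ^ M * ‖φ.1 k‖ ≤ B := fun M hM k =>
      (mul_le_mul_of_nonneg_right (pow_le_pow_right₀ (by simp) hM) (norm_nonneg _)).trans (hB k)
    calc ‖(a + b) φ‖ ≤ ‖a φ‖ + ‖b φ‖ := norm_add_le _ _
      _ ≤ C * B + C' * B :=
        add_le_add (h φ B (key _ (by omega))) (h' φ B (key _ (by omega)))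
      _ = (C + C') * B := by ring
  smul_mem' := by
    rintro c a ⟨N, C, h⟩
    refine ⟨N, ‖c‖ * C, fun φ B hB => ?_⟩
    calc ‖(c • a) φ‖ = ‖c‖ * ‖a φ‖ := by simp
      _ ≤ ‖c‖ * (C * B) := by gcongr; exact h φ B hB
      _ = ‖c‖ * C * B := by ring

lemma one_add_norm_le {n : ℕ} (k m : Zn n) : 1 + ‖k‖ ≤ (1 + ‖m‖) * (1 + ‖k - m‖) := by
  have h : ‖k‖ ≤ ‖m‖ + ‖k - m‖ := by
    simpa using norm_add_le m (k - m)
  nlinarith [mul_nonneg (norm_nonneg m) (norm_nonneg (k - m))]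

lemma norm_chi {n : ℕ} (k : Zn n) (w : Tn n) : ‖chi k w‖ = 1 := by
  simp only [chi, UnitAddTorus.mFourier, ContinuousMap.coe_mk, fourier_apply, norm_prod,
    Circle.norm_coe, Finset.prod_const_one]

/-- The complex conjugate of the time-frequency shift `M_w T_m g(k) = e^{2πi w·k} g(k - m)` of a
Schwartz function `g` on `ℤⁿ`. -/
def conjShiftZ {n : ℕ} (g : schwartzZ n) (m : Zn n) (w : Tn n) : schwartzZ n :=
  ⟨fun k => conj (chi k w * g.1 (k - m)), by
    intro N
    obtain ⟨C, hC⟩ := g.2 N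
    refine ⟨(1 + ‖m‖) ^ N * C, fun k => ?_⟩
    calc (1 + ‖k‖) ^ N * ‖conj (chi k w * g.1 (k - m))‖
        = (1 + ‖k‖) ^ N * ‖g.1 (k - m)‖ := by
          rw [RCLike.norm_conj, norm_mul, norm_chi, one_mul]
      _ ≤ ((1 + ‖m‖) * (1 + ‖k - m‖)) ^ N * ‖g.1 (k - m)‖ := by
          gcongr
          exact one_add_norm_le k m
      _ = (1 + ‖m‖) ^ N * ((1 + ‖k - m‖) ^ N * ‖g.1 (k - m)‖) := by rw [mul_pow]; ring
      _ ≤ (1 + ‖m‖) ^ N * C := by gcongr; exact hC _⟩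

/-- The short-time Fourier transform `V_g f(m, w) = ⟨f, M_w T_m g⟩` of a tempered distribution `f`
on `ℤⁿ` with respect to a Schwartz window `g`. -/
def stftZ {n : ℕ} (g : schwartzZ n) (f : temperedZ n) (z : Zn n × Tn n) : ℂ :=
  f.1 (conjShiftZ g z.1 z.2)

/-- The measure on `ℤⁿ × 𝕋ⁿ`. -/
def muPh (n : ℕ) : Measure (Zn n × Tn n) := Measure.count.prod (haarT n)

/-- The modulation space `M^p(ℤⁿ)`, defined with the window `g`. -/
def modZ {n : ℕ} (g : schwartzZ n) (p : ℝ≥0∞) : Submodule ℂ (temperedZ n) where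
  carrier := {f | MemLp (stftZ g f) p (muPh n)}
  zero_mem' := by
    have h : stftZ g (0 : temperedZ n) = 0 := by ext z; simp [stftZ]
    simp [h]
  add_mem' := by
    intro a b ha hb
    have h : stftZ g (a + b) = stftZ g a + stftZ g b := by ext z; simp [stftZ]
    simpa [h] using MemLp.add ha hb
  smul_mem' := by
    intro c a ha
    have h : stftZ g (c • a) = c • stftZ g a := by ext z; simp [stftZ]
    simpa [h] using MemLp.const_smul ha c

/-- The norm of `M^p(ℤⁿ)`, defined with the window `g`. -/
def modZNorm {n : ℕ} (g : schwartzZ n) (p : ℝ≥0∞) (f : temperedZ n) : ℝ :=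
  (eLpNorm (stftZ g f) p (muPh n)).toReal

/-- The unit mass `δ_k`, as an element of `𝓢(ℤⁿ)`. -/
def deltaZ {n : ℕ} (k : Zn n) : schwartzZ n :=
  ⟨Pi.single k 1, by
    intro N
    refine ⟨(1 + ‖k‖) ^ N, fun l => ?_⟩
    by_cases h : l = k
    · subst h; simp
    · simp only [Pi.single_eq_of_ne h, norm_zero, mul_zero]; positivity⟩

/-- A tempered distribution on `ℤⁿ` is a function on `ℤⁿ`, with the values `f(k) = f(δ_k)`. -/
def valZ {n : ℕ} (f : temperedZ n) (k : Zn n) : ℂ := f.1 (deltaZ k)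

/-- The short-time Fourier transform
`V_g f(m, w) = ∑_k f(k) conj(g(k - m)) e^{-2πi w·k}` with respect to a window `g` which need not be
a Schwartz function. -/
def stftSum {n : ℕ} (g f : temperedZ n) (m : Zn n) (w : Tn n) : ℂ :=
  ∑' k : Zn n, valZ f k * conj (valZ g (k - m)) * chi (-k) w

/-! ### Schwartz functions and tempered distributions on `ℤⁿ × 𝕋ⁿ` -/

/-- A function on `𝕋ⁿ`, as a periodic function on `ℝⁿ`. -/
def liftT {n : ℕ} (F : Tn n → ℂ) (x : Fin n → ℝ) : ℂ := F fun i => (x i : UnitAddCircle)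

/-- The Schwartz space `𝓢(ℤⁿ × 𝕋ⁿ)`: the functions which are smooth in the second variable and
rapidly decreasing in the first variable, together with all their derivatives in the second. -/
def schwartzPh (n : ℕ) : Submodule ℂ (Zn n → Tn n → ℂ) where
  carrier := {φ | (∀ m, ContDiff ℝ ∞ (liftT (φ m))) ∧
    ∀ N r : ℕ, ∃ C : ℝ, ∀ m x, (1 + ‖m‖) ^ N * ‖iteratedFDeriv ℝ r (liftT (φ m)) x‖ ≤ C}
  zero_mem' := by
    have h : ∀ m : Zn n, liftT ((0 : Zn n → Tn n → ℂ) m) = 0 := fun m => rfl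
    refine ⟨fun m => by rw [h]; exact contDiff_const, fun N r => ⟨0, fun m x => ?_⟩⟩
    rw [h, show (0 : (Fin n → ℝ) → ℂ) = fun _ => 0 from rfl, iteratedFDeriv_fun_zero]
    simp
  add_mem' := by
    rintro a b ⟨ha, ha'⟩ ⟨hb, hb'⟩
    have h : ∀ m : Zn n, liftT ((a + b) m) = liftT (a m) + liftT (b m) := fun m => rfl
    refine ⟨fun m => by rw [h]; exact (ha m).add (hb m), fun N r => ?_⟩
    obtain ⟨A, hA⟩ := ha' N r
    obtain ⟨B, hB⟩ := hb' N r
    refine ⟨A + B, fun m x => ?_⟩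
    rw [h, iteratedFDeriv_add ((ha m).of_le (by exact_mod_cast le_top))
      ((hb m).of_le (by exact_mod_cast le_top))]
    calc _ ≤ (1 + ‖m‖) ^ N * (‖iteratedFDeriv ℝ r (liftT (a m)) x‖
          + ‖iteratedFDeriv ℝ r (liftT (b m)) x‖) := by
          gcongr
          exact norm_add_le _ _
      _ ≤ A + B := by rw [mul_add]; exact add_le_add (hA m x) (hB m x)
  smul_mem' := by
    rintro c a ⟨ha, ha'⟩
    have h : ∀ m : Zn n, liftT ((c • a) m) = c • liftT (a m) := fun m => rfl
    refine ⟨fun m => by rw [h]; exact (ha m).const_smul c, fun N r => ?_⟩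
    obtain ⟨A, hA⟩ := ha' N r
    refine ⟨‖c‖ * A, fun m x => ?_⟩
    rw [h, iteratedFDeriv_const_smul_apply (((ha m).of_le (by exact_mod_cast le_top)).contDiffAt),
      norm_smul]
    calc _ = ‖c‖ * ((1 + ‖m‖) ^ N * ‖iteratedFDeriv ℝ r (liftT (a m)) x‖) := by ring
      _ ≤ ‖c‖ * A := by gcongr; exact hA m x

/-- The space `𝓢'(ℤⁿ × 𝕋ⁿ)` of tempered distributions: the linear functionals on `𝓢(ℤⁿ × 𝕋ⁿ)`
which are continuous, i.e. bounded by a multiple of one of the (increasing) seminorms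
`max_{r ≤ N} sup_{m,x} (1 + |m|)^N |∂^r φ(m, x)|`. -/
def temperedPh (n : ℕ) : Set (Module.Dual ℂ (schwartzPh n)) :=
  {u | ∃ (N : ℕ) (C : ℝ), ∀ (φ : schwartzPh n) (B : ℝ),
    (∀ r ≤ N, ∀ m x, (1 + ‖m‖) ^ N * ‖iteratedFDeriv ℝ r (liftT (φ.1 m)) x‖ ≤ B) →
      ‖u φ‖ ≤ C * B}

lemma liftT_chi_add {n : ℕ} (j : Zn n) (a y : Fin n → ℝ) :
    liftT (chi j) (a + y) = liftT (chi j) a * liftT (chi j) y := by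
  simp [liftT, chi, UnitAddTorus.mFourier, ← Finset.prod_mul_distrib, fourier_apply,
    AddCircle.toCircle_add, smul_add]

lemma contDiff_liftT_chi {n : ℕ} (j : Zn n) : ContDiff ℝ ∞ (liftT (chi j)) := by
  have h : liftT (chi j) = fun x : Fin n → ℝ =>
      ∏ i, Complex.exp (2 * Real.pi * Complex.I * (j i : ℂ) * ((x i : ℝ) : ℂ)) := by
    funext x
    simp only [liftT, chi, UnitAddTorus.mFourier, ContinuousMap.coe_mk]
    refine Finset.prod_congr rfl fun i _ => ?_
    rw [fourier_coe_apply]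
    simp
  rw [h]
  refine contDiff_prod fun i _ => ContDiff.cexp (contDiff_const.mul ?_)
  exact Complex.ofRealCLM.contDiff.comp (contDiff_apply ℝ ℝ i)

lemma norm_iteratedFDeriv_chi {n : ℕ} (j : Zn n) (r : ℕ) (a : Fin n → ℝ) :
    ‖iteratedFDeriv ℝ r (liftT (chi j)) a‖ = ‖iteratedFDeriv ℝ r (liftT (chi j)) 0‖ := by
  have h1 : (fun y => liftT (chi j) (a + y)) = liftT (chi j) a • liftT (chi j) := by
    funext y
    simp [liftT_chi_add]
  have h2 := iteratedFDeriv_comp_add_left (𝕜 := ℝ) (f := liftT (chi j)) r a 0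
  rw [h1, iteratedFDeriv_const_smul_apply
    (((contDiff_liftT_chi j).of_le (by exact_mod_cast le_top)).contDiffAt), add_zero] at h2
  rw [← h2, norm_smul]
  simp [liftT, norm_chi]

lemma exists_real_lift {n : ℕ} (x : Tn n) :
    ∃ y : Fin n → ℝ, (fun i => (y i : UnitAddCircle)) = x := by
  choose y hy using fun i => QuotientAddGroup.mk_surjective (x i)
  exact ⟨y, funext hy⟩

/-- The complex conjugate of the time-frequency shift
`M_{(ξ, j)} T_{(m, x)} Φ(m', w') = e^{2πi (ξ·m' + j·w')} Φ(m' - m, w' - x)` of a Schwartz function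
`Φ` on `ℤⁿ × 𝕋ⁿ`, for `(m, x) ∈ ℤⁿ × 𝕋ⁿ` and `(ξ, j)` in the dual group `𝕋ⁿ × ℤⁿ`. -/
def conjShiftPh {n : ℕ} (Φ : schwartzPh n) (m : Zn n) (x : Tn n) (ξ : Tn n) (j : Zn n) :
    schwartzPh n :=
  ⟨fun m' w' => conj (chi m' ξ * chi j w' * Φ.1 (m' - m) (w' - x)), by
    obtain ⟨y, rfl⟩ := exists_real_lift x
    set G : Zn n → (Fin n → ℝ) → ℂ := fun m' z =>
      liftT (chi j) z * liftT (Φ.1 (m' - m)) (z - y) with hG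
    have hsm : ∀ m', ContDiff ℝ ∞ fun z => liftT (Φ.1 (m' - m)) (z - y) := fun m' =>
      (Φ.2.1 (m' - m)).comp (contDiff_id.sub contDiff_const)
    have hGs : ∀ m', ContDiff ℝ ∞ (G m') := fun m' => (contDiff_liftT_chi j).mul (hsm m')
    have h : ∀ m', liftT (fun w' => conj (chi m' ξ * chi j w' *
        Φ.1 (m' - m) (w' - fun i => (y i : UnitAddCircle)))) =
        Complex.conjLIE ∘ (chi m' ξ • G m') := by
      intro m'
      funext z
      simp only [liftT, hG, Function.comp, Pi.smul_apply, smul_eq_mul, Complex.conjLIE_apply]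
      rw [mul_assoc]
      rfl
    refine ⟨fun m' => ?_, fun N r => ?_⟩
    · rw [h]
      exact Complex.conjLIE.contDiff.comp (contDiff_const.smul (hGs m'))
    · choose C hC using fun s => Φ.2.2 N s
      refine ⟨∑ i ∈ Finset.range (r + 1), (r.choose i : ℝ) *
        ‖iteratedFDeriv ℝ i (liftT (chi j)) 0‖ * ((1 + ‖m‖) ^ N * C (r - i)), fun m' z => ?_⟩
      rw [h, LinearIsometryEquiv.norm_iteratedFDeriv_comp_left,
        iteratedFDeriv_const_smul_apply
          (((hGs m').of_le (by exact_mod_cast le_top)).contDiffAt), norm_smul, norm_chi, one_mul]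
      calc (1 + ‖m'‖) ^ N * ‖iteratedFDeriv ℝ r (G m') z‖
          ≤ (1 + ‖m'‖) ^ N * ∑ i ∈ Finset.range (r + 1), (r.choose i : ℝ) *
            ‖iteratedFDeriv ℝ i (liftT (chi j)) z‖ *
            ‖iteratedFDeriv ℝ (r - i) (fun z => liftT (Φ.1 (m' - m)) (z - y)) z‖ := by
            gcongr
            exact norm_iteratedFDeriv_mul_le (contDiff_liftT_chi j) (hsm m') z
              (by exact_mod_cast le_top)
        _ ≤ _ := by
            rw [Finset.mul_sum]
            refine Finset.sum_le_sum fun i _ => ?_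
            rw [norm_iteratedFDeriv_chi, iteratedFDeriv_comp_sub]
            have e : (1 + ‖m'‖) ^ N ≤ (1 + ‖m‖) ^ N * (1 + ‖m' - m‖) ^ N := by
              rw [← mul_pow]
              gcongr
              exact one_add_norm_le m' m
            calc _ = (r.choose i : ℝ) * ‖iteratedFDeriv ℝ i (liftT (chi j)) 0‖ *
                  ((1 + ‖m'‖) ^ N *
                    ‖iteratedFDeriv ℝ (r - i) (liftT (Φ.1 (m' - m))) (z - y)‖) := by ring
              _ ≤ (r.choose i : ℝ) * ‖iteratedFDeriv ℝ i (liftT (chi j)) 0‖ *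
                  ((1 + ‖m‖) ^ N * (1 + ‖m' - m‖) ^ N *
                    ‖iteratedFDeriv ℝ (r - i) (liftT (Φ.1 (m' - m))) (z - y)‖) := by gcongr
              _ ≤ _ := by
                  rw [mul_assoc ((1 + ‖m‖) ^ N)]
                  gcongr
                  exact hC (r - i) (m' - m) (z - y)⟩

/-- The short-time Fourier transform `V_Φ σ = ⟨σ, M_{(ξ, j)} T_{(m, x)} Φ⟩` of a tempered
distribution `σ` on `ℤⁿ × 𝕋ⁿ` with respect to the window `Φ`, a function of `((m, x), (ξ, j))`. -/
def stftPh {n : ℕ} (Φ : schwartzPh n) (σ : Module.Dual ℂ (schwartzPh n))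
    (z : (Zn n × Tn n) × (Tn n × Zn n)) : ℂ :=
  σ (conjShiftPh Φ z.1.1 z.1.2 z.2.1 z.2.2)

/-- The measure on `(ℤⁿ × 𝕋ⁿ) × (𝕋ⁿ × ℤⁿ)`. -/
def muPhPh (n : ℕ) : Measure ((Zn n × Tn n) × (Tn n × Zn n)) :=
  (muPh n).prod ((haarT n).prod Measure.count)

/-- The modulation space `M^p(ℤⁿ × 𝕋ⁿ)`, defined with the window `Φ`. -/
def modPh {n : ℕ} (Φ : schwartzPh n) (p : ℝ≥0∞) : Set (Module.Dual ℂ (schwartzPh n)) :=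
  {σ | σ ∈ temperedPh n ∧ MemLp (stftPh Φ σ) p (muPhPh n)}

/-- The norm of `M^p(ℤⁿ × 𝕋ⁿ)`, defined with the window `Φ`. -/
def modPhNorm {n : ℕ} (Φ : schwartzPh n) (p : ℝ≥0∞) (σ : Module.Dual ℂ (schwartzPh n)) : ℝ :=
  (eLpNorm (stftPh Φ σ) p (muPhPh n)).toReal

/-- The function `(m', w') ↦ 1` if `m' = 0` and `0` otherwise, as an element of `𝓢(ℤⁿ × 𝕋ⁿ)`. -/
def unitWindow (n : ℕ) : schwartzPh n :=
  ⟨fun m' _ => (Pi.single 0 1 : Zn n → ℂ) m', by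
    have h : ∀ m' : Zn n, liftT (fun _ : Tn n => (Pi.single 0 1 : Zn n → ℂ) m') =
        fun _ => (Pi.single 0 1 : Zn n → ℂ) m' := fun m' => rfl
    refine ⟨fun m' => by rw [h]; exact contDiff_const, fun N r => ?_⟩
    refine ⟨‖iteratedFDeriv ℝ r (fun _ : Fin n → ℝ => (1 : ℂ)) 0‖, fun m' x => ?_⟩
    rw [h]
    by_cases hm : m' = 0
    · subst hm
      rcases Nat.eq_zero_or_pos r with hr | hr
      · subst hr; simp
      · rw [Pi.single_eq_same, iteratedFDeriv_const_of_ne (by omega)]; simp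
    · rw [Pi.single_eq_of_ne hm, iteratedFDeriv_fun_zero]; simp⟩

/-- The function `(m', w') ↦ e^{2πi j·w'}` if `m' = m` and `0` otherwise, as an element of
`𝓢(ℤⁿ × 𝕋ⁿ)`. -/
def atomPh {n : ℕ} (m j : Zn n) : schwartzPh n := conjShiftPh (unitWindow n) m 0 0 (-j)

lemma atomPh_apply {n : ℕ} (m j m' : Zn n) (w' : Tn n) :
    (atomPh m j).1 m' w' = if m' = m then chi j w' else 0 := by
  have h0 : chi m' (0 : Tn n) = 1 := by simp [chi, UnitAddTorus.mFourier]
  by_cases h : m' = m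
  · subst h
    have h1 : conj (chi (-j) w') = chi j w' := by
      simp only [chi, UnitAddTorus.mFourier_neg, Complex.conj_conj]
    simp [atomPh, conjShiftPh, unitWindow, h0, h1]
  · have h' : m' - m ≠ 0 := sub_ne_zero.mpr h
    simp [atomPh, conjShiftPh, unitWindow, h]
    right
    simp [Pi.single_eq_of_ne h']

/-- The terms of the duality pairing
`σ(H) = ∑_{m, j} σ(δ_m ⊗ e^{2πi j·}) ∫ H(m, w) e^{-2πi j·w} dw`
of a distribution `σ` and a function `H` on `ℤⁿ × 𝕋ⁿ`: the function `H` is expanded in a Fourier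
series in the second variable. For a distribution `σ` given by a function this is
`∑_m ∫ σ(m, w) H(m, w) dw`. -/
def pairTerm {n : ℕ} (σ : Module.Dual ℂ (schwartzPh n)) (H : Zn n → Tn n → ℂ)
    (mj : Zn n × Zn n) : ℂ :=
  σ (atomPh mj.1 mj.2) * ∫ w, H mj.1 w * chi (-mj.2) w ∂(haarT n)

/-- The function `(m, w) ↦ V_{g₁} f(m, w) M_w T_m g₂(k)`. -/
def locKernel {n : ℕ} (g₁ g₂ f : temperedZ n) (k : Zn n) (m : Zn n) (w : Tn n) : ℂ :=
  stftSum g₁ f m w * (chi k w * valZ g₂ (k - m))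

/-- `T` is the localization operator with symbol `σ` and windows `g₁`, `g₂` on `M^q(ℤⁿ)`:
`T f(k) = ∑_m ∫ σ(m, w) V_{g₁} f(m, w) M_w T_m g₂(k) dw`, where all series converge (absolutely) and
the right-hand side is the pairing of the distribution `σ` with the function
`(m, w) ↦ V_{g₁} f(m, w) M_w T_m g₂(k)`. -/
def IsLocOp {n : ℕ} (γ : schwartzZ n) (q : ℝ≥0∞) (σ : Module.Dual ℂ (schwartzPh n))
    (g₁ g₂ : temperedZ n) (T : modZ γ q →ₗ[ℂ] modZ γ q) : Prop :=
  ∀ f : modZ γ q,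
    (∀ m, Summable fun k => valZ f.1 k * conj (valZ g₁ (k - m))) ∧
    ∀ k, HasSum (pairTerm σ (locKernel g₁ g₂ f.1 k)) (valZ (T f).1 k)

/-- The distribution `σ` is given by the function `s`. -/
def IsGivenBy {n : ℕ} (σ : Module.Dual ℂ (schwartzPh n)) (s : Zn n × Tn n → ℂ) : Prop :=
  ∀ φ : schwartzPh n, HasSum (fun m => ∫ w, s (m, w) * φ.1 m w ∂(haarT n)) (σ φ)

end LocOp

end

/-! On a lattice, modulation norms collapse to sequence norms. For fixed m the function w ↦ V_γ f(m,
w) is an absolutely convergent trigonometric series with coefficients f(k) conj γ(k - m).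
Minkowski's inequality bounds its L^q norm over phase space by ‖γ‖₁ ‖f‖_q (`eLpNorm_stftZ_le`);
isolating the coefficient k = m + k₀ bounds it below by |γ(k₀)| ‖f‖_q (`le_eLpNorm_stftZ`). So
M^q(ℤⁿ) is ℓ^q, with constants independent of q.

The symbol acts only through its values on the atoms δ_m ⊗ e^{2πi j·}, and membership in any M^p, p
≥ 1, makes these bounded. Indeed a tempered distribution is the sum of its values on atoms weighted
by Fourier coefficients (`hasSum_temperedPh`), so for fixed m, j the transform V_Φ σ is an
absolutely convergent trigonometric series in (x, ξ). Each coefficient is an atom value times a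
Fourier coefficient of Φ; it is at most the L¹ norm, hence the L^p norm, of that slice, and the
slice carries unit mass in the counting variables (`enorm_atomPh_le`).

By orthogonality of characters the operator becomes a double series over (m, j). With a = k - m and
b = k - j - m it reads ∑ σ_{a,b}(k) g₂(a) conj g₁(b) f(k + b - a), where the σ_{a,b}(k) are atom
values. It is a superposition of translates of f with bounded multipliers, and Minkowski's
inequality gives the factor ‖g₁‖₁ ‖g₂‖₁ (`eLpNorm_locFun_le`). -/

namespace LocOp

/-! ### General facts -/

/-- A functional which is bounded by a weighted `ℓ¹`-norm of coefficients is the sum of its values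
on the corresponding atoms. -/
lemma hasSum_of_norm_le_tsum {ι V : Type*} [AddCommGroup V] [Module ℂ V] [DecidableEq ι]
    (u : V →ₗ[ℂ] ℂ) (e : ι → V) (c : ι → V →ₗ[ℂ] ℂ)
    (hce : ∀ i j, c i (e j) = if i = j then 1 else 0) (w : ι → ℝ) (K : ℝ)
    (hK : ∀ φ, ‖u φ‖ ≤ K * ∑' i, w i * ‖c i φ‖) (φ : V) :
    HasSum (fun i => u (e i) * c i φ) (u φ) := by
  have h1 : ∀ s : Finset ι, ∀ i, c i (φ - ∑ j ∈ s, c j φ • e j) = if i ∈ s then 0 else c i φ := by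
    intro s i
    simp only [map_sub, map_sum, map_smul, smul_eq_mul, hce, mul_ite, mul_one, mul_zero,
      Finset.sum_ite_eq]
    split_ifs <;> simp
  have h2 : ∀ s : Finset ι, ∑' i, w i * ‖c i (φ - ∑ j ∈ s, c j φ • e j)‖ =
      ∑' i : {i // i ∉ s}, w i * ‖c i φ‖ := by
    intro s
    have := tsum_subtype {i | i ∉ s} (fun i => w i * ‖c i φ‖)
    refine (tsum_congr fun i => ?_).trans this.symm
    rw [h1]
    by_cases hi : i ∈ s <;> simp [Set.indicator, hi]
  -- No summability is needed: if the series diverges, so does every cofinite part, and all these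
  -- `tsum`s take the default value 0.
  have h3 := (tendsto_tsum_compl_atTop_zero (fun i => w i * ‖c i φ‖)).const_mul K
  rw [mul_zero] at h3
  rw [HasSum, SummationFilter.unconditional_filter, tendsto_iff_norm_sub_tendsto_zero]
  refine squeeze_zero (fun _ => norm_nonneg _) (fun s => ?_) h3
  have h4 : ∑ b ∈ s, u (e b) * c b φ - u φ = -u (φ - ∑ j ∈ s, c j φ • e j) := by
    simp only [map_sub, map_sum, map_smul, smul_eq_mul, mul_comm (u (e _)), neg_sub]
  rw [h4, norm_neg, ← h2]
  exact hK _

/-- Minkowski's inequality for series. -/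
lemma eLpNorm_le_tsum_of_hasSum {α ι : Type*} [MeasurableSpace α] {μ : Measure α} [Countable ι]
    {p : ℝ≥0∞} (hp : 1 ≤ p) {F : ι → α → ℂ} {G : α → ℂ}
    (hF : ∀ i, AEStronglyMeasurable (F i) μ) (hG : ∀ x, HasSum (fun i => F i x) (G x)) :
    eLpNorm G p μ ≤ ∑' i, eLpNorm (F i) p μ := by
  -- Countability of the index set replaces the net of finite subsets by a sequence, to which the
  -- Fatou property of the L^p norm applies.
  obtain ⟨s, hs⟩ := Filter.exists_seq_tendsto (Filter.atTop : Filter (Finset ι))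
  refine (Lp.eLpNorm_lim_le_liminf_eLpNorm (f := fun N x => ∑ i ∈ s N, F i x) (fun N => ?_) G
    (Filter.Eventually.of_forall fun x => (hG x).comp hs)).trans ?_
  · exact Finset.aestronglyMeasurable_fun_sum _ fun i _ => hF i
  · refine (Filter.liminf_le_liminf (Filter.Eventually.of_forall fun N => ?_)).trans
      (Filter.liminf_const (f := (Filter.atTop : Filter ℕ)) (∑' i, eLpNorm (F i) p μ)).le
    have h := (eLpNorm_sum_le (s := s N) (fun i _ => hF i) hp).trans (ENNReal.sum_le_tsum (s N))
    have e : (fun x => ∑ i ∈ s N, F i x) = ∑ i ∈ s N, F i := by ext; simp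
    rw [e]
    exact h

/-- The coefficients of an absolutely convergent series of orthonormal bounded functions. -/
lemma integral_mul_conj_of_hasSum {α ι : Type*} [MeasurableSpace α] {ν : Measure α}
    [IsProbabilityMeasure ν] [Countable ι] [DecidableEq ι] {e : ι → α → ℂ}
    (he : ∀ i, Measurable (e i)) (hn : ∀ i x, ‖e i x‖ = 1)
    (ho : ∀ i j, ∫ x, e i x * conj (e j x) ∂ν = if i = j then 1 else 0)
    {b : ι → ℂ} (hb : Summable fun i => ‖b i‖) {F : α → ℂ}
    (hF : ∀ x, HasSum (fun i => b i * e i x) (F x)) (j : ι) :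
    ∫ x, F x * conj (e j x) ∂ν = b j := by
  have hN : ∀ i x, ‖b i * e i x * conj (e j x)‖ = ‖b i‖ := fun i x => by simp [hn]
  have hI : ∀ i, Integrable (fun x => b i * e i x * conj (e j x)) ν := by
    intro i
    refine Integrable.of_bound (C := ‖b i‖) ?_ (Filter.Eventually.of_forall fun x => (hN i x).le)
    have hc : Measurable fun x => conj (e j x) := Complex.continuous_conj.measurable.comp (he j)
    exact (((he i).const_mul _).mul hc).aestronglyMeasurable
  have h := hasSum_integral_of_summable_integral_norm hI (by simpa [hN, hn] using hb)
  have e1 : ∀ x, ∑' i, b i * e i x * conj (e j x) = F x * conj (e j x) := fun x =>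
    ((hF x).mul_right _).tsum_eq
  simp only [e1] at h
  refine h.unique ?_
  have e2 : ∀ i, ∫ x, b i * e i x * conj (e j x) ∂ν = if i = j then b j else 0 := by
    intro i
    simp only [mul_assoc]
    rw [integral_const_mul, ho]
    split_ifs with hij <;> simp [hij]
  simp only [e2]
  exact hasSum_ite_eq j (b j)

/-- A coefficient is an integral against a unimodular function, hence at most the L¹ norm; on a
probability space this is at most the L^p norm. -/
lemma enorm_le_eLpNorm_of_hasSum {α ι : Type*} [MeasurableSpace α] {ν : Measure α}
    [IsProbabilityMeasure ν] [Countable ι] [DecidableEq ι] {e : ι → α → ℂ}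
    (he : ∀ i, Measurable (e i)) (hn : ∀ i x, ‖e i x‖ = 1)
    (ho : ∀ i j, ∫ x, e i x * conj (e j x) ∂ν = if i = j then 1 else 0)
    {b : ι → ℂ} (hb : Summable fun i => ‖b i‖) {F : α → ℂ} (hFm : AEStronglyMeasurable F ν)
    (hF : ∀ x, HasSum (fun i => b i * e i x) (F x)) {p : ℝ≥0∞} (hp : 1 ≤ p) (j : ι) :
    ‖b j‖ₑ ≤ eLpNorm F p ν := by
  rw [← integral_mul_conj_of_hasSum he hn ho hb hF j]
  calc _ ≤ ∫⁻ x, ‖F x * conj (e j x)‖ₑ ∂ν := enorm_integral_le_lintegral_enorm _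
    _ = eLpNorm F 1 ν := by
        rw [eLpNorm_one_eq_lintegral_enorm]
        refine lintegral_congr fun x => ?_
        have h1 : ‖conj (e j x)‖ₑ = 1 := by
          rw [← ofReal_norm, RCLike.norm_conj, hn]; simp
        rw [enorm_mul, h1, mul_one]
    _ ≤ eLpNorm F p ν := eLpNorm_le_eLpNorm_of_exponent_le hp hFm

lemma eLpNorm_count_top_le {α : Type*} [MeasurableSpace α] (h : α → ℂ) {B : ℝ≥0∞}
    (hB : ∀ a, ‖h a‖ₑ ≤ B) : eLpNorm h ⊤ Measure.count ≤ B := by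
  rw [eLpNorm_exponent_top]
  exact essSup_le_of_ae_le _ (Filter.Eventually.of_forall hB)

lemma enorm_le_eLpNorm_count {α : Type*} [MeasurableSpace α] [MeasurableSingletonClass α]
    (h : α → ℂ) {p : ℝ≥0∞} (hp : p ≠ 0) (a : α) : ‖h a‖ₑ ≤ eLpNorm h p Measure.count := by
  have h1 : eLpNorm h p (Measure.dirac a) ≤ eLpNorm h p Measure.count := by
    refine eLpNorm_mono_measure _ ?_
    refine Measure.le_iff.2 fun s hs => ?_
    rw [Measure.dirac_apply' _ hs, Measure.count_apply hs]
    by_cases ha : a ∈ s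
    · simp only [indicator_of_mem ha, Pi.one_apply]
      exact Set.one_le_encard_iff_nonempty.2 ⟨a, ha⟩ |> fun h => by exact_mod_cast h
    · simp [indicator_of_notMem ha]
  refine le_trans ?_ h1
  by_cases hp' : p = ⊤
  · subst hp'
    have h2 : ∀ᵐ x ∂(Measure.dirac a), ‖h x‖ₑ ≤ eLpNormEssSup h (Measure.dirac a) :=
      ae_le_eLpNormEssSup
    rw [ae_dirac_eq] at h2
    rw [eLpNorm_exponent_top]
    exact h2
  · rw [eLpNorm_eq_lintegral_rpow_enorm_toReal hp hp', lintegral_dirac, ← ENNReal.rpow_mul,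
      mul_one_div_cancel (ENNReal.toReal_pos hp hp').ne', ENNReal.rpow_one]

/-- The `L^q`-norm over a product with a counting measure dominates the `ℓ^q`-norm of pointwise
lower bounds for the `L^q`-norms of the slices. -/
lemma eLpNorm_count_le_of_slice {α β : Type*} [MeasurableSpace α] [MeasurableSingletonClass α]
    [Countable α] [MeasurableSpace β] {ν : Measure β} [SFinite ν] {q : ℝ≥0∞} (hq : q ≠ 0)
    {h : α → ℂ} {V : α × β → ℂ} (hV : AEStronglyMeasurable V (Measure.count.prod ν))
    (hh : ∀ a, ‖h a‖ₑ ≤ eLpNorm (fun b => V (a, b)) q ν) :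
    eLpNorm h q Measure.count ≤ eLpNorm V q (Measure.count.prod ν) := by
  by_cases hq' : q = ⊤
  · subst hq'
    refine eLpNorm_count_top_le _ fun a => (hh a).trans ?_
    have h1 : ∀ᵐ z ∂(Measure.count.prod ν), ‖V z‖ₑ ≤ eLpNorm V ⊤ (Measure.count.prod ν) := by
      rw [eLpNorm_exponent_top]
      exact ae_le_eLpNormEssSup
    rw [eLpNorm_exponent_top]
    exact essSup_le_of_ae_le _ (Measure.ae_count_iff.1 (Measure.ae_ae_of_ae_prod h1) a)
  · have hr := ENNReal.toReal_pos hq hq'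
    rw [eLpNorm_eq_lintegral_rpow_enorm_toReal hq hq', eLpNorm_eq_lintegral_rpow_enorm_toReal hq hq']
    refine ENNReal.rpow_le_rpow ?_ (by positivity)
    rw [lintegral_prod _ (hV.enorm.pow_const _), lintegral_count, lintegral_count]
    refine ENNReal.tsum_le_tsum fun a => ?_
    have h2 := hh a
    rw [eLpNorm_eq_lintegral_rpow_enorm_toReal hq hq'] at h2
    calc _ ≤ ((∫⁻ b, ‖V (a, b)‖ₑ ^ q.toReal ∂ν) ^ (1 / q.toReal)) ^ q.toReal := by gcongr
      _ = _ := by rw [← ENNReal.rpow_mul, one_div_mul_cancel hr.ne', ENNReal.rpow_one]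

/-! ### The lattice -/

lemma summable_inv_one_add_abs_sq : Summable fun j : ℤ => ((1 + |(j : ℝ)|) ^ 2)⁻¹ := by
  have h1 : Summable fun j : ℤ => 1 / (j : ℝ) ^ 2 := Real.summable_one_div_int_pow.2 (by norm_num)
  have h2 : Summable fun j : ℤ => if j = 0 then (1 : ℝ) else 0 := (hasSum_ite_eq 0 1).summable
  refine Summable.of_nonneg_of_le (fun j => by positivity) (fun j => ?_) (h1.add h2)
  by_cases hj : j = 0
  · subst hj; simp
  · have hj' : 0 < |(j : ℝ)| := by positivity
    rw [if_neg hj, add_zero, one_div, ← sq_abs (j : ℝ)]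
    gcongr
    linarith

/-- The sup norm dominates every coordinate, so the exponent 2n supplies a square for each of the n
coordinates and the sum is dominated by a product of one-dimensional sums. -/
lemma summable_inv_one_add_norm_pow (n : ℕ) :
    Summable fun k : Zn n => ((1 + ‖k‖) ^ (2 * n))⁻¹ := by
  classical
  have h : Summable fun k : Zn n => ∏ i, ((1 + |(k i : ℝ)|) ^ 2)⁻¹ := by
    refine summable_of_sum_le (c := ∏ _i : Fin n, ∑' j : ℤ, ((1 + |(j : ℝ)|) ^ 2)⁻¹)
      (fun k => Finset.prod_nonneg fun i _ => by positivity) fun s => ?_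
    calc ∑ k ∈ s, ∏ i, ((1 + |(k i : ℝ)|) ^ 2)⁻¹
        ≤ ∑ k ∈ Fintype.piFinset fun i => s.image fun k : Zn n => k i,
            ∏ i, ((1 + |(k i : ℝ)|) ^ 2)⁻¹ := by
          refine Finset.sum_le_sum_of_subset_of_nonneg (fun k hk => ?_)
            fun k _ _ => Finset.prod_nonneg fun i _ => by positivity
          exact Fintype.mem_piFinset.2 fun i => Finset.mem_image_of_mem _ hk
      _ = ∏ i, ∑ j ∈ s.image fun k : Zn n => k i, ((1 + |(j : ℝ)|) ^ 2)⁻¹ :=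
          (Finset.prod_univ_sum _ fun _ (j : ℤ) => ((1 + |(j : ℝ)|) ^ 2)⁻¹).symm
      _ ≤ _ := Finset.prod_le_prod (fun i _ => Finset.sum_nonneg fun j _ => by positivity)
          fun i _ => summable_inv_one_add_abs_sq.sum_le_tsum _ fun j _ => by positivity
  refine Summable.of_nonneg_of_le (fun k => by positivity) (fun k => ?_) h
  rw [Finset.prod_inv_distrib]
  refine inv_anti₀ (Finset.prod_pos fun i _ => by positivity) ?_
  calc ∏ i, (1 + |(k i : ℝ)|) ^ 2 ≤ ∏ _i : Fin n, (1 + ‖k‖) ^ 2 := by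
        refine Finset.prod_le_prod (fun i _ => by positivity) fun i _ => ?_
        gcongr
        have := norm_le_pi_norm k i
        rwa [Int.norm_eq_abs] at this
    _ = _ := by rw [Finset.prod_const, Finset.card_univ, Fintype.card_fin, ← pow_mul]

lemma eLpNorm_count_comp_add_right {n : ℕ} (h : Zn n → ℂ) (a : Zn n) (q : ℝ≥0∞) :
    eLpNorm (fun k => h (k + a)) q Measure.count = eLpNorm h q Measure.count :=
  eLpNorm_comp_measurePreserving (measurable_of_countable h).aestronglyMeasurable
    (measurePreserving_add_right Measure.count a)

/-! ### The torus -/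

instance isProbabilityMeasure_haarT (n : ℕ) : IsProbabilityMeasure (haarT n) :=
  inferInstanceAs (IsProbabilityMeasure (Measure.pi _))

instance isAddRightInvariant_haarT (n : ℕ) : (haarT n).IsAddRightInvariant :=
  inferInstanceAs (Measure.pi _).IsAddRightInvariant

lemma continuous_chi {n : ℕ} (k : Zn n) : Continuous (chi k) := (UnitAddTorus.mFourier k).continuous

lemma measurable_chi {n : ℕ} (k : Zn n) : Measurable (chi k) := (continuous_chi k).measurable

lemma chi_neg {n : ℕ} (k : Zn n) (w : Tn n) : chi (-k) w = conj (chi k w) :=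
  UnitAddTorus.mFourier_neg

lemma chi_add {n : ℕ} (k l : Zn n) (w : Tn n) : chi (k + l) w = chi k w * chi l w :=
  UnitAddTorus.mFourier_add

lemma chi_zero {n : ℕ} (w : Tn n) : chi (0 : Zn n) w = 1 := by
  simp [chi, UnitAddTorus.mFourier_zero]

lemma chi_apply_zero {n : ℕ} (k : Zn n) : chi k (0 : Tn n) = 1 := by
  simp [chi, UnitAddTorus.mFourier]

lemma chi_apply_add {n : ℕ} (k : Zn n) (v w : Tn n) : chi k (v + w) = chi k v * chi k w := by
  simp [chi, UnitAddTorus.mFourier, ← Finset.prod_mul_distrib, fourier_apply, AddCircle.toCircle_add,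
    smul_add]

/-- Half a period of the character `chi k` in direction `i`. -/
lemma chi_half_period {n : ℕ} {k : Zn n} {i : Fin n} (hi : k i ≠ 0) :
    chi k (fun j => ((Pi.single i (1 / (2 * (k i : ℝ))) : Fin n → ℝ) j : UnitAddCircle)) = -1 := by
  classical
  simp only [chi, UnitAddTorus.mFourier, ContinuousMap.coe_mk]
  rw [Finset.prod_eq_single i]
  · have h := fourier_add_half_inv_index (T := 1) hi one_pos 0
    rw [zero_add, fourier_eval_zero] at h
    rw [Pi.single_eq_same, ← h, div_div]
  · intro j _ hj
    rw [Pi.single_eq_of_ne hj]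
    simp
  · simp

/-- Translation by half a period preserves the integral and changes its sign. -/
lemma integral_chi {n : ℕ} (k : Zn n) : ∫ w, chi k w ∂(haarT n) = if k = 0 then 1 else 0 := by
  split_ifs with h
  · simp [h, chi_zero]
  · obtain ⟨i, hi⟩ := Function.ne_iff.1 h
    set a : Tn n := fun j => ((Pi.single i (1 / (2 * (k i : ℝ))) : Fin n → ℝ) j : UnitAddCircle)
      with ha
    have h1 : ∫ w, chi k w ∂(haarT n) = ∫ w, chi k (w + a) ∂(haarT n) :=
      (integral_add_right_eq_self _ a).symm
    simp only [chi_apply_add, ha, chi_half_period hi, mul_neg_one, integral_neg] at h1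
    exact CharZero.eq_neg_self_iff.1 h1

lemma integral_chi_mul_conj {n : ℕ} (k l : Zn n) :
    ∫ w, chi k w * conj (chi l w) ∂(haarT n) = if k = l then 1 else 0 := by
  simp only [← chi_neg, ← chi_add, integral_chi, ← sub_eq_add_neg, sub_eq_zero]

/-! ### Tempered distributions and modulation spaces on the lattice -/

lemma summable_schwartzZ {n : ℕ} (φ : schwartzZ n) (N : ℕ) :
    Summable fun k => (1 + ‖k‖) ^ N * ‖φ.1 k‖ := by
  obtain ⟨C, hC⟩ := φ.2 (N + 2 * n)
  refine Summable.of_nonneg_of_le (fun k => by positivity) (fun k => ?_)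
    ((summable_inv_one_add_norm_pow n).mul_left C)
  rw [← div_eq_mul_inv, le_div_iff₀ (by positivity)]
  calc _ = (1 + ‖k‖) ^ (N + 2 * n) * ‖φ.1 k‖ := by rw [pow_add]; ring
    _ ≤ C := hC k

/-- A supremum seminorm is at most the corresponding weighted ℓ¹ norm, which is finite on Schwartz
functions; continuity thus forces expansion in the unit masses. -/
lemma hasSum_temperedZ {n : ℕ} (f : temperedZ n) (φ : schwartzZ n) :
    HasSum (fun k => valZ f k * φ.1 k) (f.1 φ) := by
  obtain ⟨N, C, h⟩ := f.2
  refine hasSum_of_norm_le_tsum f.1 deltaZ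
    (fun k => (LinearMap.proj k).comp (schwartzZ n).subtype) (fun i j => ?_)
    (fun k => (1 + ‖k‖) ^ N) C (fun φ => h φ _ fun k => ?_) φ
  · simp [deltaZ, Pi.single_apply]
  · exact (summable_schwartzZ φ N).le_tsum k fun j _ => by positivity

lemma temperedZ_ext {n : ℕ} {f g : temperedZ n} (h : ∀ k, valZ f k = valZ g k) : f = g := by
  refine Subtype.ext (LinearMap.ext fun φ => (hasSum_temperedZ f φ).unique ?_)
  simp only [h]
  exact hasSum_temperedZ g φ

lemma valZ_add {n : ℕ} (f g : temperedZ n) (k : Zn n) : valZ (f + g) k = valZ f k + valZ g k := rfl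

lemma valZ_smul {n : ℕ} (c : ℂ) (f : temperedZ n) (k : Zn n) : valZ (c • f) k = c * valZ f k := rfl

lemma summable_mul_schwartzZ {n : ℕ} {h : Zn n → ℂ} {B : ℝ} (hB : ∀ k, ‖h k‖ ≤ B)
    (φ : schwartzZ n) : Summable fun k => h k * φ.1 k := by
  refine Summable.of_norm_bounded ((summable_schwartzZ φ 0).mul_left B) fun k => ?_
  rw [pow_zero, one_mul, norm_mul]
  gcongr
  exact hB k

/-- The tempered distribution given by a bounded function on `ℤⁿ`. -/
noncomputable def distOfBounded {n : ℕ} (h : Zn n → ℂ) (hb : ∃ B, ∀ k, ‖h k‖ ≤ B) : temperedZ n :=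
  ⟨{ toFun := fun φ => ∑' k, h k * φ.1 k
     map_add' := fun φ ψ => by
      obtain ⟨B, hB⟩ := hb
      rw [← (summable_mul_schwartzZ hB φ).tsum_add (summable_mul_schwartzZ hB ψ)]
      exact tsum_congr fun k => by simp [mul_add]
     map_smul' := fun c φ => by
      rw [RingHom.id_apply, smul_eq_mul, ← tsum_mul_left]
      exact tsum_congr fun k => by simp [mul_left_comm] }, by
    obtain ⟨B, hB⟩ := hb
    -- The seminorm of order 2n suffices because (1 + ‖k‖)^(-2n) is summable.
    refine ⟨2 * n, B * ∑' k : Zn n, ((1 + ‖k‖) ^ (2 * n))⁻¹, fun φ D hD => ?_⟩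
    have hs := (summable_inv_one_add_norm_pow n).mul_left (B * D)
    refine (tsum_of_norm_bounded hs.hasSum fun k => ?_).trans (le_of_eq ?_)
    · have h1 : ‖φ.1 k‖ ≤ D * ((1 + ‖k‖) ^ (2 * n))⁻¹ := by
        rw [← div_eq_mul_inv, le_div_iff₀ (by positivity), mul_comm]
        exact hD k
      rw [norm_mul, mul_assoc]
      exact mul_le_mul (hB k) h1 (norm_nonneg _) ((norm_nonneg _).trans (hB k))
    · rw [tsum_mul_left]; ring⟩

lemma valZ_distOfBounded {n : ℕ} (h : Zn n → ℂ) (hb : ∃ B, ∀ k, ‖h k‖ ≤ B) (k : Zn n) :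
    valZ (distOfBounded h hb) k = h k := by
  change ∑' l, h l * (Pi.single k 1 : Zn n → ℂ) l = h k
  rw [tsum_eq_single k fun l hl => by simp [Pi.single_eq_of_ne hl]]
  simp

lemma hasSum_stftZ {n : ℕ} (g : schwartzZ n) (f : temperedZ n) (m : Zn n) (w : Tn n) :
    HasSum (fun k => valZ f k * conj (g.1 (k - m)) * chi (-k) w) (stftZ g f (m, w)) := by
  refine (hasSum_temperedZ f (conjShiftZ g m w)).congr_fun fun k => ?_
  simp only [conjShiftZ, map_mul, chi_neg]
  ring

lemma summable_norm_stftZ {n : ℕ} (g : schwartzZ n) (f : temperedZ n) (m : Zn n) :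
    Summable fun k => ‖valZ f k * conj (g.1 (k - m))‖ := by
  have h := (hasSum_stftZ g f m 0).summable
  simp only [chi_apply_zero, mul_one] at h
  exact h.norm

lemma continuous_stftZ {n : ℕ} (g : schwartzZ n) (f : temperedZ n) (m : Zn n) :
    Continuous fun w => stftZ g f (m, w) := by
  have h : (fun w => stftZ g f (m, w)) =
      fun w => ∑' k, valZ f k * conj (g.1 (k - m)) * chi (-k) w :=
    funext fun w => (hasSum_stftZ g f m w).tsum_eq.symm
  rw [h]
  refine continuous_tsum (fun k => continuous_const.mul (continuous_chi _))
    (summable_norm_stftZ g f m) fun k w => ?_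
  rw [norm_mul, norm_chi, mul_one]

lemma measurable_stftZ {n : ℕ} (g : schwartzZ n) (f : temperedZ n) : Measurable (stftZ g f) :=
  measurable_from_prod_countable_right fun m => (continuous_stftZ g f m).measurable

/-- With k = l + m the transform is a sum over l of terms of modulus |g(l)| |f(m + l)|. These do not
depend on w, and the torus has mass 1, so each has norm |g(l)| ‖f‖_q. -/
lemma eLpNorm_stftZ_le {n : ℕ} (g : schwartzZ n) (f : temperedZ n) {q : ℝ≥0∞} (hq : 1 ≤ q) :
    eLpNorm (stftZ g f) q (muPh n) ≤
      (∑' k, ‖g.1 k‖ₑ) * eLpNorm (valZ f) q Measure.count := by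
  set F : Zn n → Zn n × Tn n → ℂ := fun l z =>
    valZ f (l + z.1) * conj (g.1 l) * chi (-(l + z.1)) z.2 with hF
  have hsum : ∀ z, HasSum (fun l => F l z) (stftZ g f z) := by
    rintro ⟨m, w⟩
    have h := (Equiv.addRight m).hasSum_iff.2 (hasSum_stftZ g f m w)
    refine h.congr_fun fun l => ?_
    simp [hF]
  have hmeas : ∀ l, Measurable (F l) := fun l =>
    measurable_from_prod_countable_right fun m => (measurable_chi (-(l + m))).const_mul (valZ f (l + m) * conj (g.1 l))
  refine (eLpNorm_le_tsum_of_hasSum hq (fun l => (hmeas l).aestronglyMeasurable) hsum).trans ?_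
  rw [← ENNReal.tsum_mul_right]
  refine ENNReal.tsum_le_tsum fun l => ?_
  have h1 : eLpNorm (F l) q (muPh n) =
      eLpNorm (conj (g.1 l) • ((fun k => valZ f (k + l)) ∘ Prod.fst)) q (muPh n) := by
    refine eLpNorm_congr_norm_ae (Filter.Eventually.of_forall fun z => ?_)
    simp [hF, norm_chi, mul_comm, add_comm]
  rw [h1, eLpNorm_const_smul, muPh, eLpNorm_comp_measurePreserving
    (measurable_of_countable _).aestronglyMeasurable measurePreserving_fst,
    eLpNorm_count_comp_add_right]
  rw [← ofReal_norm, RCLike.norm_conj, ofReal_norm]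

/-- For each m, a single Fourier coefficient of the slice w ↦ V_g f(m, w), namely f(m + k₀) conj
g(k₀), already bounds the slice norm from below. -/
lemma le_eLpNorm_stftZ {n : ℕ} (g : schwartzZ n) (f : temperedZ n) {q : ℝ≥0∞} (hq : 1 ≤ q)
    (k₀ : Zn n) :
    ‖g.1 k₀‖ₑ * eLpNorm (valZ f) q Measure.count ≤ eLpNorm (stftZ g f) q (muPh n) := by
  have h : ‖g.1 k₀‖ₑ * eLpNorm (valZ f) q Measure.count =
      eLpNorm (fun m => valZ f (m + k₀) * conj (g.1 k₀)) q Measure.count := by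
    rw [← eLpNorm_count_comp_add_right (valZ f) k₀]
    have h1 := eLpNorm_const_smul (conj (g.1 k₀)) (fun m => valZ f (m + k₀)) q Measure.count
    rw [← ofReal_norm, RCLike.norm_conj, ofReal_norm] at h1
    rw [← h1]
    congr 1
    ext m
    simp [mul_comm]
  rw [h]
  refine eLpNorm_count_le_of_slice (by positivity) (measurable_stftZ g f).aestronglyMeasurable
    fun m => ?_
  have h2 := enorm_le_eLpNorm_of_hasSum (ν := haarT n) (e := fun k => chi (-k))
    (fun k => measurable_chi _) (fun k w => norm_chi _ w)
    (fun k l => by simp only [integral_chi_mul_conj, neg_inj]) (summable_norm_stftZ g f m)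
    (continuous_stftZ g f m).aestronglyMeasurable (hasSum_stftZ g f m) hq (m + k₀)
  simpa using h2

lemma eLpNorm_valZ_lt_top {n : ℕ} {g : schwartzZ n} (hg : g ≠ 0) {q : ℝ≥0∞} (hq : 1 ≤ q)
    {f : temperedZ n} (hf : f ∈ modZ g q) : eLpNorm (valZ f) q Measure.count < ⊤ := by
  obtain ⟨k₀, hk⟩ : ∃ k, g.1 k ≠ 0 := by
    by_contra! h
    exact hg (Subtype.ext (funext h))
  have h := (le_eLpNorm_stftZ g f hq k₀).trans_lt hf.2
  by_contra h'
  rw [not_lt, top_le_iff] at h'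
  rw [h', ENNReal.mul_top (by simpa using hk)] at h
  exact lt_irrefl _ h

lemma mem_modZ_of_eLpNorm_valZ {n : ℕ} {g : schwartzZ n} {q : ℝ≥0∞} (hq : 1 ≤ q)
    {f : temperedZ n} (hf : eLpNorm (valZ f) q Measure.count < ⊤) : f ∈ modZ g q := by
  refine ⟨(measurable_stftZ g f).aestronglyMeasurable, (eLpNorm_stftZ_le g f hq).trans_lt
    (ENNReal.mul_lt_top ?_ hf)⟩
  have h := summable_schwartzZ g 0
  simp only [pow_zero, one_mul] at h
  simpa only [ofReal_norm] using h.tsum_ofReal_lt_top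

/-! ### Fourier coefficients of Schwartz functions on `ℤⁿ × 𝕋ⁿ` -/

/-- The projection ℝⁿ → 𝕋ⁿ is a quotient map, as a product of open quotient maps. -/
lemma continuous_of_liftT {n : ℕ} {F : Tn n → ℂ} (h : Continuous (liftT F)) : Continuous F := by
  have hq : IsOpenQuotientMap (Pi.map fun _ : Fin n => ((↑) : ℝ → UnitAddCircle)) :=
    IsOpenQuotientMap.piMap fun _ => QuotientAddGroup.isOpenQuotientMap_mk
  exact hq.isQuotientMap.continuous_iff.2 h

lemma continuous_schwartzPh {n : ℕ} (φ : schwartzPh n) (m : Zn n) : Continuous (φ.1 m) :=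
  continuous_of_liftT (φ.2.1 m).continuous

lemma integrable_of_continuous {n : ℕ} {F : Tn n → ℂ} (h : Continuous F) :
    Integrable F (haarT n) := by
  have : IsFiniteMeasureOnCompacts (haarT n) := inferInstance
  exact h.integrable_of_hasCompactSupport (HasCompactSupport.of_compactSpace F)

/-- The Fourier coefficients of a smooth function decay: repeatedly replacing the function by its
difference with a translate by half a period of the character. -/
lemma norm_integral_mul_chi_le {n : ℕ} {l : Zn n} {i : Fin n} (hi : l i ≠ 0) (M : ℕ) :
    ∀ (F : Tn n → ℂ) (B : ℝ), ContDiff ℝ ∞ (liftT F) →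
      (∀ x, ‖iteratedFDeriv ℝ M (liftT F) x‖ ≤ B) →
      ‖∫ w, F w * chi (-l) w ∂(haarT n)‖ ≤ (1 / (4 * |(l i : ℝ)|)) ^ M * B := by
  have hl : 0 < |(l i : ℝ)| := by positivity
  induction M with
  | zero =>
    intro F B _ hB
    rw [pow_zero, one_mul]
    refine (norm_integral_le_of_norm_le_const (C := B)
      (Filter.Eventually.of_forall fun w => ?_)).trans (by simp)
    obtain ⟨y, rfl⟩ := exists_real_lift w
    rw [norm_mul, norm_chi, mul_one]
    simpa [liftT] using hB y
  | succ M ih =>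
    intro F B hF hB
    -- The coefficient of F(· + a') - F is -2 times that of F, while the mean value inequality
    -- trades one derivative for a factor ‖a‖ = 1/(2|l i|). Each step therefore gains 1/(4|l i|).
    set a : Fin n → ℝ := Pi.single i (1 / (2 * (l i : ℝ))) with ha
    set a' : Tn n := fun j => (a j : UnitAddCircle) with ha'
    have hna : ‖a‖ = 1 / (2 * |(l i : ℝ)|) := by
      rw [ha, Pi.norm_single, Real.norm_eq_abs, abs_div, abs_mul]; simp
    have hlift : liftT (fun w => F (w + a') - F w) = fun x => liftT F (x + a) - liftT F x := rfl
    have hsh : ContDiff ℝ ∞ fun x => liftT F (x + a) := hF.comp (contDiff_id.add contDiff_const)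
    have hFc := continuous_of_liftT hF.continuous
    have h1 := ih (fun w => F (w + a') - F w) (B * ‖a‖)
      (by rw [hlift]; exact hsh.sub hF) (fun x => by
        have hd : Differentiable ℝ (iteratedFDeriv ℝ M (liftT F)) :=
          hF.differentiable_iteratedFDeriv (by exact_mod_cast ENat.natCast_lt_top M)
        have e : iteratedFDeriv ℝ M (fun x => liftT F (x + a) - liftT F x) x =
            iteratedFDeriv ℝ M (liftT F) (x + a) - iteratedFDeriv ℝ M (liftT F) x := by
          rw [← iteratedFDeriv_comp_add_right]
          exact iteratedFDeriv_sub_apply ((hsh.of_le (by exact_mod_cast le_top)).contDiffAt)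
            ((hF.of_le (by exact_mod_cast le_top)).contDiffAt)
        rw [hlift, e]
        have h2 := convex_univ.norm_image_sub_le_of_norm_fderiv_le (𝕜 := ℝ)
          (f := iteratedFDeriv ℝ M (liftT F)) (C := B) (fun y _ => hd y)
          (fun y _ => by rw [norm_fderiv_iteratedFDeriv]; exact hB y) (mem_univ x)
          (mem_univ (x + a))
        simpa using h2)
    have hchi : ∀ w : Tn n, chi (-l) (w + a') = -chi (-l) w := by
      intro w
      rw [chi_apply_add, chi_neg l a', ha', ha, chi_half_period hi]
      simp
    have h3 : ∫ w, (F (w + a') - F w) * chi (-l) w ∂(haarT n) =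
        -2 * ∫ w, F w * chi (-l) w ∂(haarT n) := by
      have h4 : ∫ w, F (w + a') * chi (-l) (w + a') ∂(haarT n) =
          ∫ w, F w * chi (-l) w ∂(haarT n) :=
        integral_add_right_eq_self (fun w => F w * chi (-l) w) a'
      simp only [hchi, mul_neg, integral_neg] at h4
      simp only [sub_mul]
      rw [integral_sub, neg_eq_iff_eq_neg.1 h4]
      · ring
      · exact integrable_of_continuous
          ((hFc.comp (continuous_id.add continuous_const)).mul (continuous_chi _))
      · exact integrable_of_continuous (hFc.mul (continuous_chi _))
    rw [h3, norm_mul, hna] at h1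
    have h5 : ‖(-2 : ℂ)‖ = 2 := by simp
    rw [h5] at h1
    have h6 : (1 / (4 * |(l i : ℝ)|)) ^ M * (B * (1 / (2 * |(l i : ℝ)|))) =
        2 * ((1 / (4 * |(l i : ℝ)|)) ^ (M + 1) * B) := by
      rw [pow_succ]; field_simp; ring
    linarith

/-- The Fourier coefficients of a Schwartz function on `ℤⁿ × 𝕋ⁿ` in the second variable. -/
noncomputable def coeffPh {n : ℕ} (z : Zn n × Zn n) : schwartzPh n →ₗ[ℂ] ℂ where
  toFun φ := ∫ w, φ.1 z.1 w * chi (-z.2) w ∂(haarT n)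
  map_add' φ ψ := by
    have h : ∀ φ : schwartzPh n, Integrable (fun w => φ.1 z.1 w * chi (-z.2) w) (haarT n) :=
      fun φ => integrable_of_continuous ((continuous_schwartzPh φ _).mul (continuous_chi _))
    rw [← integral_add (h φ) (h ψ)]
    simp [add_mul]
  map_smul' c φ := by
    rw [RingHom.id_apply, smul_eq_mul, ← integral_const_mul]
    simp [mul_assoc]

lemma coeffPh_apply {n : ℕ} (z : Zn n × Zn n) (φ : schwartzPh n) :
    coeffPh z φ = ∫ w, φ.1 z.1 w * chi (-z.2) w ∂(haarT n) := rfl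

lemma exists_coeffPh_le {n : ℕ} (φ : schwartzPh n) (N M : ℕ) :
    ∃ C, ∀ z, (1 + ‖z.1‖) ^ N * (1 + ‖z.2‖) ^ M * ‖coeffPh z φ‖ ≤ C := by
  obtain ⟨A, hA⟩ := φ.2.2 N 0
  obtain ⟨B, hB⟩ := φ.2.2 N M
  refine ⟨max A B, fun z => ?_⟩
  have hm : 0 < (1 + ‖z.1‖) ^ N := by positivity
  by_cases hz : z.2 = 0
  · refine le_trans ?_ (le_max_left A B)
    have h : ‖coeffPh z φ‖ ≤ A / (1 + ‖z.1‖) ^ N := by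
      refine (norm_integral_le_of_norm_le_const (C := A / (1 + ‖z.1‖) ^ N)
        (Filter.Eventually.of_forall fun w => ?_)).trans (by simp)
      obtain ⟨y, rfl⟩ := exists_real_lift w
      rw [norm_mul, norm_chi, mul_one, le_div_iff₀' hm]
      simpa [liftT] using hA z.1 y
    rw [le_div_iff₀' hm] at h
    simpa [hz] using h
  · refine le_trans ?_ (le_max_right A B)
    obtain ⟨i₀, _⟩ := Function.ne_iff.1 hz
    have : Nonempty (Fin n) := ⟨i₀⟩
    -- Decay is taken in a coordinate attaining the sup norm; there |z.2 i| ≥ 1, so 1 + ‖z.2‖ ≤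
    -- 4|z.2 i|.
    obtain ⟨i, hi⟩ : ∃ i, ‖z.2‖ = ‖z.2 i‖ := by
      obtain ⟨i, hi⟩ := Finite.exists_max fun i => ‖z.2 i‖
      exact ⟨i, le_antisymm ((pi_norm_le_iff_of_nonneg (norm_nonneg _)).2 hi) (norm_le_pi_norm _ i)⟩
    have hi0 : z.2 i ≠ 0 := by
      intro h
      rw [h, norm_zero, norm_eq_zero] at hi
      exact hz hi
    rw [Int.norm_eq_abs] at hi
    have h1 : (1 : ℝ) ≤ |(z.2 i : ℝ)| := by exact_mod_cast Int.one_le_abs hi0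
    have h := norm_integral_mul_chi_le hi0 M (φ.1 z.1) (B / (1 + ‖z.1‖) ^ N) (φ.2.1 z.1)
      fun x => by rw [le_div_iff₀' hm]; exact hB z.1 x
    have hB0 : 0 ≤ B := le_trans (by positivity) (hB 0 0)
    have h2 : (1 + ‖z.2‖) ^ M * (1 / (4 * |(z.2 i : ℝ)|)) ^ M ≤ 1 := by
      rw [← mul_pow]
      refine pow_le_one₀ (by positivity) ?_
      rw [hi, mul_one_div, div_le_one (by positivity)]
      linarith
    calc _ ≤ (1 + ‖z.1‖) ^ N * (1 + ‖z.2‖) ^ M *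
          ((1 / (4 * |(z.2 i : ℝ)|)) ^ M * (B / (1 + ‖z.1‖) ^ N)) := by
          gcongr
          exact h
      _ = ((1 + ‖z.2‖) ^ M * (1 / (4 * |(z.2 i : ℝ)|)) ^ M) * B := by field_simp
      _ ≤ 1 * B := by gcongr
      _ = B := one_mul B

lemma summable_coeffPh {n : ℕ} (φ : schwartzPh n) (N : ℕ) :
    Summable fun z => (1 + ‖z.1‖) ^ N * (1 + ‖z.2‖) ^ N * ‖coeffPh z φ‖ := by
  obtain ⟨C, hC⟩ := exists_coeffPh_le φ (N + 2 * n) (N + 2 * n)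
  have h := (((summable_inv_one_add_norm_pow n).mul_of_nonneg (summable_inv_one_add_norm_pow n)
    (fun k => by positivity) (fun k => by positivity))).mul_left C
  refine Summable.of_nonneg_of_le (fun k => by positivity) (fun z => ?_) h
  rw [← mul_inv, ← div_eq_mul_inv, le_div_iff₀ (by positivity)]
  calc _ = (1 + ‖z.1‖) ^ (N + 2 * n) * (1 + ‖z.2‖) ^ (N + 2 * n) * ‖coeffPh z φ‖ := by
        rw [pow_add, pow_add]; ring
    _ ≤ C := hC z

lemma summable_norm_coeffPh {n : ℕ} (φ : schwartzPh n) : Summable fun z => ‖coeffPh z φ‖ := by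
  simpa using summable_coeffPh φ 0

lemma hasSum_fourier_schwartzPh {n : ℕ} (φ : schwartzPh n) (m : Zn n) (w : Tn n) :
    HasSum (fun l => coeffPh (m, l) φ * chi l w) (φ.1 m w) := by
  have hc : UnitAddTorus.mFourierCoeff (φ.1 m) = fun l => coeffPh (m, l) φ := by
    funext l
    rw [coeffPh_apply]
    exact integral_congr_ae (Filter.Eventually.of_forall fun w => mul_comm _ _)
  have hs : Summable (UnitAddTorus.mFourierCoeff (φ.1 m)) := by
    rw [hc]
    exact Summable.of_norm ((summable_norm_coeffPh φ).comp_injective (Prod.mk_right_injective m))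
  have h := UnitAddTorus.hasSum_mFourier_series_apply_of_summable
    (f := ⟨φ.1 m, continuous_schwartzPh φ m⟩) hs w
  simp only [ContinuousMap.coe_mk, hc] at h
  exact h

/-! ### Tempered distributions on `ℤⁿ × 𝕋ⁿ` are determined by their values on atoms -/

/-- The derivative of exp ∘ L is exp ∘ L followed by a fixed linear map of norm at most ‖L‖, so
induction yields one factor per derivative. -/
lemma norm_iteratedFDeriv_cexp_le {E : Type*} [NormedAddCommGroup E] [NormedSpace ℝ E]
    (L : E →L[ℝ] ℂ) (hL : ∀ x, ‖Complex.exp (L x)‖ = 1) (r : ℕ) (x : E) :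
    ‖iteratedFDeriv ℝ r (fun x => Complex.exp (L x)) x‖ ≤ ‖L‖ ^ r := by
  have hs : ContDiff ℝ ∞ fun x => Complex.exp (L x) := L.contDiff.cexp
  induction r generalizing x with
  | zero => simp [hL]
  | succ r ih =>
    set g : ℂ →L[ℝ] (E →L[ℝ] ℂ) := (ContinuousLinearMap.id ℝ ℂ).smulRight L with hg
    have hgn : ‖g‖ ≤ ‖L‖ := ContinuousLinearMap.opNorm_le_bound _ (norm_nonneg _) fun c => by
      simp [hg, norm_smul, mul_comm]
    have hf : fderiv ℝ (fun x => Complex.exp (L x)) = g ∘ fun x => Complex.exp (L x) := by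
      funext y
      exact L.hasFDerivAt.cexp.fderiv
    rw [← norm_iteratedFDeriv_fderiv, hf, pow_succ']
    refine (ContinuousLinearMap.norm_iteratedFDeriv_comp_left g
      ((hs.of_le (by exact_mod_cast le_top)).contDiffAt (n := r)) le_rfl).trans ?_
    exact mul_le_mul hgn (ih x) (norm_nonneg _) (norm_nonneg _)

lemma norm_iteratedFDeriv_chi_le {n : ℕ} (l : Zn n) {r N : ℕ} (hr : r ≤ N) (x : Fin n → ℝ) :
    ‖iteratedFDeriv ℝ r (liftT (chi l)) x‖ ≤
      (1 + 2 * Real.pi * n) ^ N * (1 + ‖l‖) ^ N := by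
  set L : (Fin n → ℝ) →L[ℝ] ℂ := ∑ i, (2 * Real.pi * Complex.I * (l i : ℂ)) •
    (Complex.ofRealCLM.comp (ContinuousLinearMap.proj i)) with hL
  have h : liftT (chi l) = fun x => Complex.exp (L x) := by
    funext y
    simp only [liftT, chi, UnitAddTorus.mFourier, ContinuousMap.coe_mk, hL,
      _root_.sum_apply, Complex.exp_sum]
    refine Finset.prod_congr rfl fun i _ => ?_
    rw [fourier_coe_apply]
    simp
  have hnL : ‖L‖ ≤ 2 * Real.pi * n * ‖l‖ := by
    refine (norm_sum_le _ _).trans ?_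
    calc ∑ i, ‖(2 * Real.pi * Complex.I * (l i : ℂ)) •
          (Complex.ofRealCLM.comp (ContinuousLinearMap.proj i : (Fin n → ℝ) →L[ℝ] ℝ))‖
        ≤ ∑ _i : Fin n, 2 * Real.pi * ‖l‖ := by
          refine Finset.sum_le_sum fun i _ => ?_
          rw [norm_smul]
          have h1 : ‖(2 * Real.pi * Complex.I * (l i : ℂ))‖ = 2 * Real.pi * ‖l i‖ := by
            simp [abs_of_pos Real.pi_pos, Int.norm_eq_abs]
          have h2 : ‖Complex.ofRealCLM.comp
              (ContinuousLinearMap.proj i : (Fin n → ℝ) →L[ℝ] ℝ)‖ ≤ 1 :=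
            ContinuousLinearMap.opNorm_le_bound _ zero_le_one fun y => by
              simpa using norm_le_pi_norm y i
          rw [h1]
          calc _ ≤ 2 * Real.pi * ‖l‖ * 1 := by
                have := Real.pi_pos
                gcongr
                exact norm_le_pi_norm l i
            _ = _ := mul_one _
      _ = _ := by rw [Finset.sum_const, Finset.card_univ, Fintype.card_fin, nsmul_eq_mul]; ring
  have hpi := Real.pi_pos
  have h1 : ‖iteratedFDeriv ℝ r (liftT (chi l)) x‖ ≤ ‖L‖ ^ r := by
    rw [h]
    refine norm_iteratedFDeriv_cexp_le L (fun y => ?_) r x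
    rw [← congrFun h y]
    exact norm_chi _ _
  have hn : (0 : ℝ) ≤ 2 * Real.pi * n := by positivity
  have hb : ‖L‖ ≤ (1 + 2 * Real.pi * n) * (1 + ‖l‖) := by
    nlinarith [norm_nonneg l, mul_nonneg hn (norm_nonneg l)]
  have hb1 : 1 ≤ (1 + 2 * Real.pi * n) * (1 + ‖l‖) := by
    nlinarith [norm_nonneg l, mul_nonneg hn (norm_nonneg l)]
  rw [← mul_pow]
  exact h1.trans ((pow_le_pow_left₀ (norm_nonneg _) hb r).trans (pow_le_pow_right₀ hb1 hr))

/-- This converse to coefficient decay lets weighted ℓ¹ norms of coefficients control the Schwartz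
seminorms. The Fourier series is differentiated term by term, and the sum for one m is part of the
full double sum. -/
lemma norm_iteratedFDeriv_schwartzPh_le {n : ℕ} (φ : schwartzPh n) {r N : ℕ} (hr : r ≤ N)
    (m : Zn n) (x : Fin n → ℝ) :
    (1 + ‖m‖) ^ N * ‖iteratedFDeriv ℝ r (liftT (φ.1 m)) x‖ ≤
      (1 + 2 * Real.pi * n) ^ N *
        ∑' z : Zn n × Zn n, (1 + ‖z.1‖) ^ N * (1 + ‖z.2‖) ^ N * ‖coeffPh z φ‖ := by
  have hpi := Real.pi_pos
  set K : ℝ := (1 + 2 * Real.pi * n) ^ N with hK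
  have hlift : liftT (φ.1 m) = fun x => ∑' l, coeffPh (m, l) φ • liftT (chi l) x := by
    funext y
    exact (hasSum_fourier_schwartzPh φ m _).tsum_eq.symm
  have hs : Summable fun l : Zn n => (1 + ‖m‖) ^ N * (1 + ‖l‖) ^ N * ‖coeffPh (m, l) φ‖ :=
    ((summable_coeffPh φ N).comp_injective (Prod.mk_right_injective m) :)
  have hm : 0 < (1 + ‖m‖) ^ N := by positivity
  have hs' : Summable fun l : Zn n => K * ((1 + ‖l‖) ^ N * ‖coeffPh (m, l) φ‖) := by
    refine ((hs.mul_left ((1 + ‖m‖) ^ N)⁻¹).congr fun l => ?_).mul_left K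
    rw [mul_assoc, inv_mul_cancel_left₀ hm.ne']
  have hsm : ∀ l, ContDiff ℝ (N : ℕ∞) fun x => coeffPh (m, l) φ • liftT (chi l) x := fun l =>
    ((contDiff_liftT_chi l).of_le (m := ((N : ℕ∞) : WithTop ℕ∞))
      (by exact_mod_cast le_top)).const_smul (coeffPh (m, l) φ)
  have hb : ∀ (k : ℕ) (l : Zn n) (x : Fin n → ℝ), (k : ℕ∞) ≤ (N : ℕ∞) →
      ‖iteratedFDeriv ℝ k (fun x => coeffPh (m, l) φ • liftT (chi l) x) x‖ ≤
        K * ((1 + ‖l‖) ^ N * ‖coeffPh (m, l) φ‖) := by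
    intro k l x hk
    have e := iteratedFDeriv_const_smul_apply (𝕜 := ℝ) (a := coeffPh (m, l) φ) (x := x)
      (((contDiff_liftT_chi l).of_le (by exact_mod_cast le_top)).contDiffAt (n := k))
    change ‖iteratedFDeriv ℝ k (coeffPh (m, l) φ • liftT (chi l)) x‖ ≤ _
    rw [e, norm_smul]
    calc _ ≤ ‖coeffPh (m, l) φ‖ * (K * (1 + ‖l‖) ^ N) := by
          gcongr
          exact norm_iteratedFDeriv_chi_le l (by exact_mod_cast hk) x
      _ = _ := by ring
  rw [hlift, iteratedFDeriv_tsum_apply hsm (v := fun _ l => K * ((1 + ‖l‖) ^ N *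
    ‖coeffPh (m, l) φ‖)) (fun _ _ => hs') hb (by exact_mod_cast hr)]
  have h1 := tsum_of_norm_bounded hs'.hasSum fun l => hb r l x (by exact_mod_cast hr)
  calc _ ≤ (1 + ‖m‖) ^ N * ∑' l, K * ((1 + ‖l‖) ^ N * ‖coeffPh (m, l) φ‖) := by gcongr
    _ = K * ∑' l : Zn n, (1 + ‖m‖) ^ N * (1 + ‖l‖) ^ N * ‖coeffPh (m, l) φ‖ := by
        rw [← tsum_mul_left, ← tsum_mul_left]
        exact tsum_congr fun l => by ring
    _ ≤ _ := by
        have h2 := tsum_comp_le_tsum_of_inj (summable_coeffPh φ N) (fun z => by positivity)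
          (Prod.mk_right_injective m)
        exact mul_le_mul_of_nonneg_left h2 (by positivity)

lemma coeffPh_atomPh {n : ℕ} (z y : Zn n × Zn n) :
    coeffPh z (atomPh y.1 y.2) = if z = y then 1 else 0 := by
  simp only [coeffPh_apply, atomPh_apply]
  by_cases h : z.1 = y.1
  · simp only [h, if_true]
    simp only [chi_neg, integral_chi_mul_conj, Prod.ext_iff, h, true_and, eq_comm]
  · have h' : z ≠ y := fun e => h (by rw [e])
    simp [h, h']

lemma hasSum_temperedPh {n : ℕ} {σ : Module.Dual ℂ (schwartzPh n)} (hσ : σ ∈ temperedPh n)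
    (φ : schwartzPh n) : HasSum (fun z => σ (atomPh z.1 z.2) * coeffPh z φ) (σ φ) := by
  obtain ⟨N, C, h⟩ := hσ
  have hK : ∀ φ, ‖σ φ‖ ≤ C * (1 + 2 * Real.pi * n) ^ N *
      ∑' z : Zn n × Zn n, (1 + ‖z.1‖) ^ N * (1 + ‖z.2‖) ^ N * ‖coeffPh z φ‖ := by
    intro φ
    have h1 := h φ _ fun r hr m x => norm_iteratedFDeriv_schwartzPh_le φ hr m x
    rwa [← mul_assoc] at h1
  have hs := hasSum_of_norm_le_tsum σ (fun z : Zn n × Zn n => atomPh z.1 z.2) coeffPh coeffPh_atomPh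
    (fun z => (1 + ‖z.1‖) ^ N * (1 + ‖z.2‖) ^ N) (C * (1 + 2 * Real.pi * n) ^ N)
  exact hs hK φ

lemma exists_coeffPh_ne_zero {n : ℕ} {φ : schwartzPh n} (hφ : φ ≠ 0) : ∃ z, coeffPh z φ ≠ 0 := by
  by_contra! h
  refine hφ (Subtype.ext (funext fun m => funext fun w => ?_))
  refine (hasSum_fourier_schwartzPh φ m w).unique ?_
  simp [h, hasSum_zero]

/-- Modulation and translation of Φ permute its Fourier coefficients up to conjugation and
characters in ξ and x; this makes V_Φ σ a trigonometric series in (x, ξ). -/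
lemma coeffPh_conjShiftPh {n : ℕ} (Φ : schwartzPh n) (m j : Zn n) (x ξ : Tn n) (z : Zn n × Zn n) :
    coeffPh z (conjShiftPh Φ m x ξ j) =
      conj (coeffPh (z.1 - m, -(j + z.2)) Φ) * (chi (-z.1) ξ * chi (-(j + z.2)) x) := by
  have h : coeffPh z (conjShiftPh Φ m x ξ j) = ∫ w, conj (chi z.1 ξ * chi j (w + x) *
      Φ.1 (z.1 - m) (w + x - x)) * chi (-z.2) (w + x) ∂(haarT n) :=
    (integral_add_right_eq_self (fun w => conj (chi z.1 ξ * chi j w *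
      Φ.1 (z.1 - m) (w - x)) * chi (-z.2) w) x).symm
  rw [h, coeffPh_apply, ← integral_conj, ← integral_mul_const]
  refine integral_congr_ae (Filter.Eventually.of_forall fun w => ?_)
  simp only [add_sub_cancel_right, chi_neg, chi_apply_add, chi_add, map_mul, Complex.conj_conj]
  ring

lemma hasSum_stftPh {n : ℕ} (Φ : schwartzPh n) {σ : Module.Dual ℂ (schwartzPh n)}
    (hσ : σ ∈ temperedPh n) (m j : Zn n) (x ξ : Tn n) :
    HasSum (fun z : Zn n × Zn n => σ (atomPh z.1 z.2) * conj (coeffPh (z.1 - m, -(j + z.2)) Φ) *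
      (chi (-z.1) ξ * chi (-(j + z.2)) x)) (stftPh Φ σ ((m, x), (ξ, j))) := by
  refine (hasSum_temperedPh hσ (conjShiftPh Φ m x ξ j)).congr_fun fun z => ?_
  rw [coeffPh_conjShiftPh, mul_assoc]

/-- The values of a tempered distribution on the atoms are bounded by its modulation space norm. -/
lemma enorm_atomPh_le {n : ℕ} (Φ : schwartzPh n) {p : ℝ≥0∞} (hp : 1 ≤ p)
    {σ : Module.Dual ℂ (schwartzPh n)} (hσ : σ ∈ modPh Φ p) (z₀ z : Zn n × Zn n) :
    ‖coeffPh z₀ Φ‖ₑ * ‖σ (atomPh z.1 z.2)‖ₑ ≤ eLpNorm (stftPh Φ σ) p (muPhPh n) := by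
  -- The slice is chosen so that the atom value at z is multiplied by the coefficient of Φ at z₀.
  set m := z.1 - z₀.1 with hm
  set j := -z₀.2 - z.2 with hj
  set ι : Tn n × Tn n → (Zn n × Tn n) × (Tn n × Zn n) := fun y => ((m, y.1), (y.2, j)) with hι
  have hιm : Measurable ι := by fun_prop
  -- A point mass is the counting measure restricted to a point, so the slice measure is a
  -- restriction of the full one.
  have hle : Measure.map ι ((haarT n).prod (haarT n)) ≤ muPhPh n := by
    have h1 : Measure.map ι ((haarT n).prod (haarT n)) =
        ((Measure.dirac m).prod (haarT n)).prod ((haarT n).prod (Measure.dirac j)) := by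
      rw [Measure.dirac_prod, Measure.prod_dirac, Measure.map_prod_map _ _ (by fun_prop)
        (by fun_prop)]
      rfl
    have h2 : ∀ k : Zn n, Measure.dirac k = (Measure.count : Measure (Zn n)).restrict {k} := by
      intro k
      rw [Measure.restrict_singleton, Measure.count_singleton, one_smul]
    rw [h1, h2 m, h2 j, ← Measure.restrict_univ (μ := haarT n), Measure.prod_restrict,
      Measure.prod_restrict, Measure.prod_restrict]
    exact Measure.restrict_le_self
  have hF : AEStronglyMeasurable (stftPh Φ σ ∘ ι) ((haarT n).prod (haarT n)) :=
    (hσ.2.1.mono_measure hle).comp_measurable hιm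
  have hsum := fun y : Tn n × Tn n => hasSum_stftPh Φ hσ.1 m j y.1 y.2
  have hb : Summable fun z : Zn n × Zn n =>
      ‖σ (atomPh z.1 z.2) * conj (coeffPh (z.1 - m, -(j + z.2)) Φ)‖ := by
    have := (hsum 0).summable.norm
    simpa [norm_chi] using this
  have h := enorm_le_eLpNorm_of_hasSum (ν := (haarT n).prod (haarT n))
    (e := fun (z : Zn n × Zn n) (y : Tn n × Tn n) => chi (-z.1) y.2 * chi (-(j + z.2)) y.1)
    (fun z => ((measurable_chi _).comp measurable_snd).mul
      ((measurable_chi _).comp measurable_fst))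
    (fun z y => by rw [norm_mul, norm_chi, norm_chi, one_mul]) (fun a b => by
      have e : ∀ y : Tn n × Tn n, chi (-a.1) y.2 * chi (-(j + a.2)) y.1 *
          conj (chi (-b.1) y.2 * chi (-(j + b.2)) y.1) =
          (chi (-(j + a.2)) y.1 * conj (chi (-(j + b.2)) y.1)) *
            (chi (-a.1) y.2 * conj (chi (-b.1) y.2)) := fun y => by rw [map_mul]; ring
      simp only [e]
      rw [integral_prod_mul (fun x => chi (-(j + a.2)) x * conj (chi (-(j + b.2)) x))
        (fun x => chi (-a.1) x * conj (chi (-b.1) x)), integral_chi_mul_conj,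
        integral_chi_mul_conj]
      simp only [neg_inj, add_right_inj, Prod.ext_iff]
      by_cases h1 : a.1 = b.1 <;> by_cases h2 : a.2 = b.2 <;> simp [h1, h2])
    hb hF hsum hp z
  have e1 : z.1 - m = z₀.1 := by rw [hm]; abel
  have e2 : -(j + z.2) = z₀.2 := by rw [hj]; abel
  rw [e1, e2, enorm_mul, mul_comm, ← ofReal_norm (conj _), RCLike.norm_conj, ofReal_norm,
    ← eLpNorm_map_measure (hσ.2.1.mono_measure hle) hιm.aemeasurable] at h
  exact h.trans (eLpNorm_mono_measure _ hle)

/-! ### The localization operator -/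

section LocFun

variable {n : ℕ} {σ : Module.Dual ℂ (schwartzPh n)} {g₁ g₂ f : temperedZ n} {A B : ℝ}

/-- The Fourier coefficients in `w` of `V_{g₁} f(m, w) M_w T_m g₂(k)`. -/
noncomputable def locCoeff {n : ℕ} (g₁ g₂ f : temperedZ n) (k m j : Zn n) : ℂ :=
  valZ f (k - j) * conj (valZ g₁ (k - j - m)) * valZ g₂ (k - m)

lemma summable_mul_conj_shift (h₁ : Summable fun k => ‖valZ g₁ k‖) (hB : ∀ k, ‖valZ f k‖ ≤ B)
    (m : Zn n) : Summable fun k => ‖valZ f k * conj (valZ g₁ (k - m))‖ := by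
  refine Summable.of_nonneg_of_le (fun k => norm_nonneg _) (fun k => ?_)
    (((Equiv.subRight m).summable_iff.2 h₁).mul_left B)
  rw [norm_mul, RCLike.norm_conj]
  exact mul_le_mul_of_nonneg_right (hB k) (norm_nonneg _)

lemma summable_locCoeff (h₁ : Summable fun k => ‖valZ g₁ k‖) (hB : ∀ k, ‖valZ f k‖ ≤ B)
    (k m : Zn n) : Summable fun j => ‖locCoeff g₁ g₂ f k m j‖ := by
  have h := ((Equiv.subLeft k).summable_iff.2 (summable_mul_conj_shift h₁ hB m)).mul_right
    ‖valZ g₂ (k - m)‖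
  exact h.congr fun j => (norm_mul _ _).symm

/-- The factor `chi k` turns the frequency -l of V_{g₁} f into k - l; put j = k - l. -/
lemma hasSum_locKernel (h₁ : Summable fun k => ‖valZ g₁ k‖) (hB : ∀ k, ‖valZ f k‖ ≤ B)
    (k m : Zn n) (w : Tn n) :
    HasSum (fun j => locCoeff g₁ g₂ f k m j * chi j w) (locKernel g₁ g₂ f k m w) := by
  have hs : Summable fun l => valZ f l * conj (valZ g₁ (l - m)) * chi (-l) w := by
    refine Summable.of_norm ((summable_mul_conj_shift h₁ hB m).congr fun l => ?_)
    rw [norm_mul _ (chi _ _), norm_chi, mul_one]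
  have h := ((Equiv.subLeft k).hasSum_iff.2 hs.hasSum).mul_right (chi k w * valZ g₂ (k - m))
  refine h.congr_fun fun j => ?_
  simp only [Function.comp, Equiv.subLeft_apply, locCoeff]
  have e : chi (-(k - j)) w * chi k w = chi j w := by
    rw [← chi_add]
    congr 1
    abel
  rw [← e]
  ring

lemma pairTerm_locKernel (h₁ : Summable fun k => ‖valZ g₁ k‖) (hB : ∀ k, ‖valZ f k‖ ≤ B)
    (k : Zn n) (z : Zn n × Zn n) :
    pairTerm σ (locKernel g₁ g₂ f k) z = σ (atomPh z.1 z.2) * locCoeff g₁ g₂ f k z.1 z.2 := by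
  rw [pairTerm]
  congr 1
  simp only [chi_neg]
  exact integral_mul_conj_of_hasSum (e := chi) measurable_chi norm_chi integral_chi_mul_conj
    (summable_locCoeff h₁ hB k z.1) (hasSum_locKernel h₁ hB k z.1) z.2

/-- The terms of the series of the localization operator, ordered by the arguments of the
windows. -/
noncomputable def locTerm {n : ℕ} (σ : Module.Dual ℂ (schwartzPh n)) (g₁ g₂ f : temperedZ n)
    (k : Zn n) (z : Zn n × Zn n) : ℂ :=
  σ (atomPh (k - z.1) (z.1 - z.2)) * (valZ f (k + (z.2 - z.1)) * conj (valZ g₁ z.2) * valZ g₂ z.1)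

/-- The values of the localization operator. -/
noncomputable def locFun {n : ℕ} (σ : Module.Dual ℂ (schwartzPh n)) (g₁ g₂ f : temperedZ n)
    (k : Zn n) : ℂ :=
  ∑' z, locTerm σ g₁ g₂ f k z

lemma norm_locTerm_le (hA : ∀ z : Zn n × Zn n, ‖σ (atomPh z.1 z.2)‖ ≤ A) (k : Zn n)
    (z : Zn n × Zn n) :
    ‖locTerm σ g₁ g₂ f k z‖ ≤
      A * (‖valZ g₂ z.1‖ * ‖valZ g₁ z.2‖) * ‖valZ f (k + (z.2 - z.1))‖ := by
  rw [locTerm, norm_mul, norm_mul, norm_mul, RCLike.norm_conj]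
  calc _ ≤ A * (‖valZ f (k + (z.2 - z.1))‖ * ‖valZ g₁ z.2‖ * ‖valZ g₂ z.1‖) := by
        gcongr
        exact hA (k - z.1, z.1 - z.2)
    _ = _ := by ring

lemma nonneg_of_forall_norm_atomPh_le (hA : ∀ z : Zn n × Zn n, ‖σ (atomPh z.1 z.2)‖ ≤ A) : 0 ≤ A :=
  (norm_nonneg _).trans (hA 0)

lemma norm_locTerm_le_of_bounded (hA : ∀ z : Zn n × Zn n, ‖σ (atomPh z.1 z.2)‖ ≤ A)
    (hB : ∀ k, ‖valZ f k‖ ≤ B) (k : Zn n) (z : Zn n × Zn n) :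
    ‖locTerm σ g₁ g₂ f k z‖ ≤ A * B * (‖valZ g₂ z.1‖ * ‖valZ g₁ z.2‖) := by
  have hA0 := nonneg_of_forall_norm_atomPh_le hA
  refine (norm_locTerm_le hA k z).trans ?_
  calc _ ≤ A * (‖valZ g₂ z.1‖ * ‖valZ g₁ z.2‖) * B := by gcongr; exact hB _
    _ = _ := by ring

lemma summable_locTerm_bound (h₁ : Summable fun k => ‖valZ g₁ k‖)
    (h₂ : Summable fun k => ‖valZ g₂ k‖) :
    Summable fun z : Zn n × Zn n => A * B * (‖valZ g₂ z.1‖ * ‖valZ g₁ z.2‖) :=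
  (h₂.mul_of_nonneg h₁ (fun _ => norm_nonneg _) fun _ => norm_nonneg _).mul_left _

lemma summable_locTerm (hA : ∀ z : Zn n × Zn n, ‖σ (atomPh z.1 z.2)‖ ≤ A)
    (h₁ : Summable fun k => ‖valZ g₁ k‖) (h₂ : Summable fun k => ‖valZ g₂ k‖)
    (hB : ∀ k, ‖valZ f k‖ ≤ B) (k : Zn n) : Summable (locTerm σ g₁ g₂ f k) :=
  Summable.of_norm_bounded (summable_locTerm_bound h₁ h₂) (norm_locTerm_le_of_bounded hA hB k)

lemma exists_norm_locFun_le (hA : ∀ z : Zn n × Zn n, ‖σ (atomPh z.1 z.2)‖ ≤ A)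
    (h₁ : Summable fun k => ‖valZ g₁ k‖) (h₂ : Summable fun k => ‖valZ g₂ k‖)
    (hB : ∀ k, ‖valZ f k‖ ≤ B) : ∃ D, ∀ k, ‖locFun σ g₁ g₂ f k‖ ≤ D :=
  ⟨_, fun k => tsum_of_norm_bounded (summable_locTerm_bound h₁ h₂).hasSum
    (norm_locTerm_le_of_bounded hA hB k)⟩

lemma hasSum_pairTerm (hA : ∀ z : Zn n × Zn n, ‖σ (atomPh z.1 z.2)‖ ≤ A)
    (h₁ : Summable fun k => ‖valZ g₁ k‖) (h₂ : Summable fun k => ‖valZ g₂ k‖)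
    (hB : ∀ k, ‖valZ f k‖ ≤ B) (k : Zn n) :
    HasSum (pairTerm σ (locKernel g₁ g₂ f k)) (locFun σ g₁ g₂ f k) := by
  -- This is (a, b) ↦ (m, j) = (k - a, a - b), where a and b are the arguments of g₂ and g₁.
  set e : Zn n × Zn n ≃ Zn n × Zn n :=
    { toFun := fun z => (k - z.1, z.1 - z.2)
      invFun := fun z => (k - z.1, k - z.1 - z.2)
      left_inv := fun z => by ext1 <;> simp
      right_inv := fun z => by ext1 <;> simp } with he
  rw [← e.hasSum_iff]
  refine (summable_locTerm hA h₁ h₂ hB k).hasSum.congr_fun fun z => ?_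
  have e1 : k - (z.1 - z.2) = k + (z.2 - z.1) := by abel
  have e2 : k + (z.2 - z.1) - (k - z.1) = z.2 := by abel
  simp only [Function.comp, pairTerm_locKernel h₁ hB, he, Equiv.coe_fn_mk, locCoeff, locTerm, e1,
    e2, sub_sub_cancel]

/-- As a function of k, the term with index (a, b) is dominated by A |g₂(a)| |g₁(b)| times a
translate of |f|. Translation invariance and Minkowski's inequality finish, since the sum over (a,
b) factorises. -/
lemma eLpNorm_locFun_le (hA : ∀ z : Zn n × Zn n, ‖σ (atomPh z.1 z.2)‖ ≤ A)
    (h₁ : Summable fun k => ‖valZ g₁ k‖) (h₂ : Summable fun k => ‖valZ g₂ k‖)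
    (hB : ∀ k, ‖valZ f k‖ ≤ B) {q : ℝ≥0∞} (hq : 1 ≤ q) :
    eLpNorm (locFun σ g₁ g₂ f) q Measure.count ≤
      ENNReal.ofReal A * (eLpNorm (valZ g₁) 1 Measure.count * eLpNorm (valZ g₂) 1 Measure.count) *
        eLpNorm (valZ f) q Measure.count := by
  have hA0 := nonneg_of_forall_norm_atomPh_le hA
  refine (eLpNorm_le_tsum_of_hasSum (F := fun z k => locTerm σ g₁ g₂ f k z) hq
    (fun z => (measurable_of_countable _).aestronglyMeasurable)
    fun k => (summable_locTerm hA h₁ h₂ hB k).hasSum).trans ?_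
  have h : ∀ z : Zn n × Zn n, eLpNorm (fun k => locTerm σ g₁ g₂ f k z) q Measure.count ≤
      ENNReal.ofReal A * (‖valZ g₂ z.1‖ₑ * ‖valZ g₁ z.2‖ₑ) *
        eLpNorm (valZ f) q Measure.count := by
    intro z
    have hc : 0 ≤ A * (‖valZ g₂ z.1‖ * ‖valZ g₁ z.2‖) := by positivity
    have h3 := eLpNorm_const_smul (A * (‖valZ g₂ z.1‖ * ‖valZ g₁ z.2‖))
      (fun k => valZ f (k + (z.2 - z.1))) q Measure.count
    rw [eLpNorm_count_comp_add_right, Real.enorm_of_nonneg hc, ENNReal.ofReal_mul hA0,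
      ENNReal.ofReal_mul (norm_nonneg _), ofReal_norm, ofReal_norm] at h3
    rw [← h3]
    refine eLpNorm_mono fun k => (norm_locTerm_le hA k z).trans (le_of_eq ?_)
    rw [Pi.smul_apply, norm_smul, Real.norm_of_nonneg hc]
  refine (ENNReal.tsum_le_tsum h).trans (le_of_eq ?_)
  rw [ENNReal.tsum_mul_right, ENNReal.tsum_mul_left,
    ENNReal.tsum_prod (f := fun a b => ‖valZ g₂ a‖ₑ * ‖valZ g₁ b‖ₑ)]
  simp only [ENNReal.tsum_mul_left, ENNReal.tsum_mul_right, eLpNorm_one_eq_lintegral_enorm,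
    lintegral_count, mul_comm (∑' k, ‖valZ g₁ k‖ₑ)]

lemma locFun_add {f' : temperedZ n} {B' : ℝ} (hA : ∀ z : Zn n × Zn n, ‖σ (atomPh z.1 z.2)‖ ≤ A)
    (h₁ : Summable fun k => ‖valZ g₁ k‖) (h₂ : Summable fun k => ‖valZ g₂ k‖)
    (hB : ∀ k, ‖valZ f k‖ ≤ B) (hB' : ∀ k, ‖valZ f' k‖ ≤ B') (k : Zn n) :
    locFun σ g₁ g₂ (f + f') k = locFun σ g₁ g₂ f k + locFun σ g₁ g₂ f' k := by
  rw [locFun, locFun, locFun,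
    ← (summable_locTerm hA h₁ h₂ hB k).tsum_add (summable_locTerm hA h₁ h₂ hB' k)]
  exact tsum_congr fun z => by simp only [locTerm, valZ_add]; ring

lemma locFun_smul (c : ℂ) (k : Zn n) : locFun σ g₁ g₂ (c • f) k = c * locFun σ g₁ g₂ f k := by
  rw [locFun, locFun, ← tsum_mul_left]
  exact tsum_congr fun z => by simp only [locTerm, valZ_smul]; ring

lemma integrable_slice {s : Zn n × Tn n → ℂ} {p : ℝ≥0∞} (hp : 1 ≤ p) (hs : MemLp s p (muPh n))
    (m : Zn n) : Integrable (fun w => s (m, w)) (haarT n) := by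
  have hle : Measure.map (Prod.mk m) (haarT n) ≤ muPh n := by
    have h : Measure.dirac m = (Measure.count : Measure (Zn n)).restrict {m} := by
      rw [Measure.restrict_singleton, Measure.count_singleton, one_smul]
    rw [← Measure.dirac_prod, h]
    nth_rewrite 1 [← Measure.restrict_univ (μ := haarT n)]
    rw [Measure.prod_restrict]
    exact Measure.restrict_le_self
  have h := hs.mono_measure hle
  exact ((memLp_map_measure_iff h.1 measurable_prodMk_left.aemeasurable).1 h).integrable hp

lemma IsGivenBy.apply_atomPh {s : Zn n × Tn n → ℂ} (h : IsGivenBy σ s) (m j : Zn n) :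
    σ (atomPh m j) = ∫ w, s (m, w) * chi j w ∂(haarT n) := by
  refine (h (atomPh m j)).unique ?_
  simp only [atomPh_apply]
  have e := hasSum_single (f := fun m' => ∫ w, s (m', w) * (if m' = m then chi j w else 0) ∂(haarT n))
    m fun m' hm => by simp [hm]
  simpa using e

/-- Summing the double series over j first reassembles the Fourier series of the kernel under the
integral; absolute summability of its coefficients justifies the interchange. -/
lemma hasSum_integral_of_isGivenBy (hA : ∀ z : Zn n × Zn n, ‖σ (atomPh z.1 z.2)‖ ≤ A)
    (h₁ : Summable fun k => ‖valZ g₁ k‖) (h₂ : Summable fun k => ‖valZ g₂ k‖)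
    (hB : ∀ k, ‖valZ f k‖ ≤ B) {s : Zn n × Tn n → ℂ}
    (hs : ∀ m, Integrable (fun w => s (m, w)) (haarT n)) (hσ : IsGivenBy σ s) (k : Zn n) :
    HasSum (fun m => ∫ w, s (m, w) * locKernel g₁ g₂ f k m w ∂(haarT n))
      (locFun σ g₁ g₂ f k) := by
  refine (hasSum_pairTerm hA h₁ h₂ hB k).prod_fiberwise fun m => ?_
  have hN : ∀ j w, ‖s (m, w) * (locCoeff g₁ g₂ f k m j * chi j w)‖ =
      ‖s (m, w)‖ * ‖locCoeff g₁ g₂ f k m j‖ := fun j w => by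
    rw [norm_mul, norm_mul, norm_chi, mul_one]
  have hI : ∀ j, Integrable (fun w => s (m, w) * (locCoeff g₁ g₂ f k m j * chi j w)) (haarT n) := by
    intro j
    refine ((hs m).norm.mul_const ‖locCoeff g₁ g₂ f k m j‖).mono'
      ((hs m).1.mul ((measurable_chi j).const_mul _).aestronglyMeasurable)
      (Filter.Eventually.of_forall fun w => (hN j w).le)
  have h := hasSum_integral_of_summable_integral_norm hI (by
    simp only [hN, integral_mul_const]
    exact (summable_locCoeff h₁ hB k m).mul_left _)
  have e : ∀ w, ∑' j, s (m, w) * (locCoeff g₁ g₂ f k m j * chi j w) =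
      s (m, w) * locKernel g₁ g₂ f k m w := fun w =>
    ((hasSum_locKernel h₁ hB k m w).mul_left _).tsum_eq
  simp only [e] at h
  refine h.congr_fun fun j => ?_
  rw [pairTerm_locKernel h₁ hB, hσ.apply_atomPh, ← integral_mul_const]
  exact integral_congr_ae (Filter.Eventually.of_forall fun w => by ring)

end LocFun

lemma summable_norm_valZ {n : ℕ} {γ : schwartzZ n} (hγ : γ ≠ 0) {g : temperedZ n}
    (hg : g ∈ modZ γ 1) : Summable fun k => ‖valZ g k‖ := by
  have h := eLpNorm_valZ_lt_top hγ le_rfl hg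
  rw [eLpNorm_one_eq_lintegral_enorm, lintegral_count] at h
  simpa using ENNReal.summable_toReal h.ne

lemma norm_valZ_le {n : ℕ} {γ : schwartzZ n} (hγ : γ ≠ 0) {q : ℝ≥0∞} (hq : 1 ≤ q)
    {f : temperedZ n} (hf : f ∈ modZ γ q) (k : Zn n) :
    ‖valZ f k‖ ≤ (eLpNorm (valZ f) q Measure.count).toReal := by
  rw [← toReal_enorm]
  exact ENNReal.toReal_mono (eLpNorm_valZ_lt_top hγ hq hf).ne
    (enorm_le_eLpNorm_count _ (by positivity) k)

/-- The localization operator on `M^q(ℤⁿ)` of a symbol with bounded Fourier coefficients. -/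
noncomputable def locOp {n : ℕ} {γ : schwartzZ n} (hγ : γ ≠ 0) {q : ℝ≥0∞} (hq : 1 ≤ q)
    {σ : Module.Dual ℂ (schwartzPh n)} {A : ℝ} (hA : ∀ z : Zn n × Zn n, ‖σ (atomPh z.1 z.2)‖ ≤ A)
    {g₁ g₂ : temperedZ n} (hg₁ : g₁ ∈ modZ γ 1) (hg₂ : g₂ ∈ modZ γ 1) :
    modZ γ q →ₗ[ℂ] modZ γ q where
  toFun f := ⟨distOfBounded (locFun σ g₁ g₂ f.1) (exists_norm_locFun_le hA
    (summable_norm_valZ hγ hg₁) (summable_norm_valZ hγ hg₂) (norm_valZ_le hγ hq f.2)), by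
      refine mem_modZ_of_eLpNorm_valZ hq ?_
      rw [funext (valZ_distOfBounded _ _)]
      refine (eLpNorm_locFun_le hA (summable_norm_valZ hγ hg₁) (summable_norm_valZ hγ hg₂)
        (norm_valZ_le hγ hq f.2) hq).trans_lt ?_
      exact ENNReal.mul_lt_top (ENNReal.mul_lt_top ENNReal.ofReal_lt_top
        (ENNReal.mul_lt_top (eLpNorm_valZ_lt_top hγ le_rfl hg₁)
          (eLpNorm_valZ_lt_top hγ le_rfl hg₂))) (eLpNorm_valZ_lt_top hγ hq f.2)⟩
  map_add' f f' := by
    refine Subtype.ext (temperedZ_ext fun k => ?_)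
    simp only [Submodule.coe_add, valZ_add, valZ_distOfBounded]
    exact locFun_add hA (summable_norm_valZ hγ hg₁) (summable_norm_valZ hγ hg₂)
      (norm_valZ_le hγ hq f.2) (norm_valZ_le hγ hq f'.2) k
  map_smul' c f := by
    refine Subtype.ext (temperedZ_ext fun k => ?_)
    simp only [Submodule.coe_smul, RingHom.id_apply, valZ_smul, valZ_distOfBounded]
    exact locFun_smul c k

lemma valZ_locOp {n : ℕ} {γ : schwartzZ n} (hγ : γ ≠ 0) {q : ℝ≥0∞} (hq : 1 ≤ q)
    {σ : Module.Dual ℂ (schwartzPh n)} {A : ℝ} (hA : ∀ z : Zn n × Zn n, ‖σ (atomPh z.1 z.2)‖ ≤ A)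
    {g₁ g₂ : temperedZ n} (hg₁ : g₁ ∈ modZ γ 1) (hg₂ : g₂ ∈ modZ γ 1) (f : modZ γ q) (k : Zn n) :
    valZ (locOp hγ hq hA hg₁ hg₂ f).1 k = locFun σ g₁ g₂ f.1 k :=
  valZ_distOfBounded _ (exists_norm_locFun_le hA (summable_norm_valZ hγ hg₁)
    (summable_norm_valZ hγ hg₂) (norm_valZ_le hγ hq f.2)) k

/-! ### The norm estimate -/

lemma norm_mul_toReal_eLpNorm_valZ_le {n : ℕ} {γ : schwartzZ n} {q : ℝ≥0∞}
    (hq : 1 ≤ q) {f : temperedZ n} (hf : f ∈ modZ γ q) (k₀ : Zn n) :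
    ‖γ.1 k₀‖ * (eLpNorm (valZ f) q Measure.count).toReal ≤ modZNorm γ q f := by
  have h := ENNReal.toReal_mono hf.2.ne (le_eLpNorm_stftZ γ f hq k₀)
  rwa [ENNReal.toReal_mul, toReal_enorm] at h

lemma modZNorm_le {n : ℕ} {γ : schwartzZ n} (hγ : γ ≠ 0) {q : ℝ≥0∞} (hq : 1 ≤ q)
    {f : temperedZ n} (hf : f ∈ modZ γ q) :
    modZNorm γ q f ≤ (∑' k, ‖γ.1 k‖) * (eLpNorm (valZ f) q Measure.count).toReal := by
  have hs : ∑' k, ‖γ.1 k‖ₑ < ⊤ := by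
    have h := summable_schwartzZ γ 0
    simp only [pow_zero, one_mul] at h
    simpa only [ofReal_norm] using h.tsum_ofReal_lt_top
  have h := ENNReal.toReal_mono (ENNReal.mul_lt_top hs (eLpNorm_valZ_lt_top hγ hq hf)).ne
    (eLpNorm_stftZ_le γ f hq)
  rw [ENNReal.toReal_mul, ENNReal.tsum_toReal_eq fun k => enorm_ne_top] at h
  simp only [toReal_enorm] at h
  exact h

/-- Passing from ℓ^q back to M^q costs ‖γ‖₁; replacing the sequence norms of g₁, g₂ and f by
modulation norms costs 1/|γ(k₀)| each, hence the cube. -/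
lemma modZNorm_locOp_le {n : ℕ} {γ : schwartzZ n} (hγ : γ ≠ 0) {q : ℝ≥0∞} (hq : 1 ≤ q)
    {σ : Module.Dual ℂ (schwartzPh n)} {A : ℝ} (hA : ∀ z : Zn n × Zn n, ‖σ (atomPh z.1 z.2)‖ ≤ A)
    {g₁ g₂ : temperedZ n} (hg₁ : g₁ ∈ modZ γ 1) (hg₂ : g₂ ∈ modZ γ 1) (f : modZ γ q) {k₀ : Zn n}
    (hk₀ : γ.1 k₀ ≠ 0) :
    modZNorm γ q (locOp hγ hq hA hg₁ hg₂ f).1 ≤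
      (∑' k, ‖γ.1 k‖) / ‖γ.1 k₀‖ ^ 3 * (A * modZNorm γ 1 g₁ * modZNorm γ 1 g₂) *
        modZNorm γ q f.1 := by
  have hA0 := nonneg_of_forall_norm_atomPh_le hA
  have h0 : 0 < ‖γ.1 k₀‖ := norm_pos_iff.2 hk₀
  have hS : 0 ≤ ∑' k, ‖γ.1 k‖ := tsum_nonneg fun k => norm_nonneg _
  have hf1 := eLpNorm_valZ_lt_top hγ le_rfl hg₁
  have hf2 := eLpNorm_valZ_lt_top hγ le_rfl hg₂
  have hff := eLpNorm_valZ_lt_top hγ hq f.2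
  have h1 := norm_mul_toReal_eLpNorm_valZ_le le_rfl hg₁ k₀
  have h2 := norm_mul_toReal_eLpNorm_valZ_le le_rfl hg₂ k₀
  have h3 := norm_mul_toReal_eLpNorm_valZ_le hq f.2 k₀
  have h4 := modZNorm_le hγ hq (locOp hγ hq hA hg₁ hg₂ f).2
  have h5 := ENNReal.toReal_mono (ENNReal.mul_lt_top (ENNReal.mul_lt_top ENNReal.ofReal_lt_top
        (ENNReal.mul_lt_top hf1 hf2)) hff).ne
    (eLpNorm_locFun_le hA (summable_norm_valZ hγ hg₁) (summable_norm_valZ hγ hg₂)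
      (norm_valZ_le hγ hq f.2) hq)
  rw [← funext (valZ_locOp hγ hq hA hg₁ hg₂ f)] at h5
  simp only [ENNReal.toReal_mul, ENNReal.toReal_ofReal hA0] at h5
  rw [← le_div_iff₀' h0] at h1 h2 h3
  calc _ ≤ _ := h4
    _ ≤ (∑' k, ‖γ.1 k‖) * (A * (modZNorm γ 1 g₁ / ‖γ.1 k₀‖ * (modZNorm γ 1 g₂ / ‖γ.1 k₀‖)) *
        (modZNorm γ q f.1 / ‖γ.1 k₀‖)) := by
        refine mul_le_mul_of_nonneg_left (h5.trans ?_) hS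
        have i1 := ENNReal.toReal_nonneg.trans h1
        have i2 := ENNReal.toReal_nonneg.trans h2
        gcongr
    _ = _ := by field_simp

lemma norm_atomPh_le {n : ℕ} {Φ : schwartzPh n} {p : ℝ≥0∞} (hp : 1 ≤ p)
    {σ : Module.Dual ℂ (schwartzPh n)} (hσ : σ ∈ modPh Φ p) {z₀ : Zn n × Zn n}
    (hz₀ : coeffPh z₀ Φ ≠ 0) (z : Zn n × Zn n) :
    ‖σ (atomPh z.1 z.2)‖ ≤ modPhNorm Φ p σ / ‖coeffPh z₀ Φ‖ := by
  have h := ENNReal.toReal_mono hσ.2.2.ne (enorm_atomPh_le Φ hp hσ z₀ z)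
  rw [ENNReal.toReal_mul, toReal_enorm, toReal_enorm] at h
  rwa [le_div_iff₀' (norm_pos_iff.2 hz₀)]

lemma coeffPh_unitWindow {n : ℕ} : coeffPh 0 (unitWindow n) = 1 := by
  simp [coeffPh_apply, unitWindow, chi_zero]

lemma tsum_norm_deltaZ {n : ℕ} : ∑' k, ‖(deltaZ (0 : Zn n)).1 k‖ = 1 := by
  rw [tsum_eq_single 0 fun k hk => by simp [deltaZ, Pi.single_eq_of_ne hk]]
  simp [deltaZ]

end LocOp

theorem mainTheorem3 (n : ℕ) (γ : LocOp.schwartzZ n) (hγ : γ ≠ 0)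
    (Φ : LocOp.schwartzPh n) (hΦ : Φ ≠ 0) :
    ∃ C : ℝ, 0 < C ∧
      (γ = LocOp.deltaZ 0 → Φ = LocOp.unitWindow n → C = 1) ∧
      ∀ (p q : ℝ≥0∞), 1 ≤ p → 1 ≤ q →
      ∀ σ ∈ LocOp.modPh Φ p, ∀ g₁ ∈ LocOp.modZ γ 1, ∀ g₂ ∈ LocOp.modZ γ 1,
      ∃ T : LocOp.modZ γ q →ₗ[ℂ] LocOp.modZ γ q,
        LocOp.IsLocOp γ q σ g₁ g₂ T ∧
        (∀ s : LocOp.Zn n × LocOp.Tn n → ℂ,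
          (MemLp s 1 (LocOp.muPh n) ∨ MemLp s ∞ (LocOp.muPh n)) → LocOp.IsGivenBy σ s →
          ∀ (f : LocOp.modZ γ q) (k : LocOp.Zn n),
            HasSum (fun m => ∫ w, s (m, w) * LocOp.locKernel g₁ g₂ f.1 k m w ∂(LocOp.haarT n))
              (LocOp.valZ (T f).1 k)) ∧
        ∀ f : LocOp.modZ γ q,
          LocOp.modZNorm γ q (T f).1 ≤
            C * (LocOp.modPhNorm Φ p σ * LocOp.modZNorm γ 1 g₁ * LocOp.modZNorm γ 1 g₂) *
              LocOp.modZNorm γ q f.1 := by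
  open LocOp in
  -- Any non-zero value of γ and coefficient of Φ give some constant. For the standard windows both
  -- are taken at 0, where they equal 1, so that C = 1.
  obtain ⟨k₀, z₀, hk₀, hz₀, hstd⟩ : ∃ (k₀ : Zn n) (z₀ : Zn n × Zn n), γ.1 k₀ ≠ 0 ∧
      coeffPh z₀ Φ ≠ 0 ∧ (γ = deltaZ 0 → Φ = unitWindow n → k₀ = 0 ∧ z₀ = 0) := by
    by_cases h : γ = deltaZ 0 ∧ Φ = unitWindow n
    · refine ⟨0, 0, ?_, ?_, fun _ _ => ⟨rfl, rfl⟩⟩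
      · rw [h.1]; simp [deltaZ]
      · rw [h.2, coeffPh_unitWindow]; exact one_ne_zero
    · obtain ⟨z₀, hz₀⟩ := exists_coeffPh_ne_zero hΦ
      obtain ⟨k₀, hk₀⟩ : ∃ k, γ.1 k ≠ 0 := by
        by_contra! h'
        exact hγ (Subtype.ext (funext h'))
      exact ⟨k₀, z₀, hk₀, hz₀, fun h1 h2 => absurd ⟨h1, h2⟩ h⟩
  have hk := norm_pos_iff.2 hk₀
  have hz := norm_pos_iff.2 hz₀
  have hsum : Summable fun k => ‖γ.1 k‖ := by simpa using summable_schwartzZ γ 0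
  have hS : 0 < ∑' k, ‖γ.1 k‖ := hsum.tsum_pos (fun k => norm_nonneg _) k₀ hk
  -- The last divisor comes from bounding the atom values of σ by its M^p norm.
  refine ⟨(∑' k, ‖γ.1 k‖) / ‖γ.1 k₀‖ ^ 3 / ‖coeffPh z₀ Φ‖, by positivity, fun h1 h2 => ?_,
    fun p q hp hq σ hσ g₁ hg₁ g₂ hg₂ => ?_⟩
  · obtain ⟨rfl, rfl⟩ := hstd h1 h2
    rw [h1, h2, tsum_norm_deltaZ, coeffPh_unitWindow]
    simp [deltaZ]
  · have hA := norm_atomPh_le hp hσ hz₀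
    have s₁ := summable_norm_valZ hγ hg₁
    have s₂ := summable_norm_valZ hγ hg₂
    refine ⟨locOp hγ hq hA hg₁ hg₂, fun f => ⟨fun m => ?_, fun k => ?_⟩,
      fun s hs hσs f k => ?_, fun f => ?_⟩
    · exact (summable_mul_conj_shift s₁ (norm_valZ_le hγ hq f.2) m).of_norm
    · rw [valZ_locOp]
      exact hasSum_pairTerm hA s₁ s₂ (norm_valZ_le hγ hq f.2) k
    · rw [valZ_locOp]
      refine hasSum_integral_of_isGivenBy hA s₁ s₂ (norm_valZ_le hγ hq f.2) (fun m => ?_) hσs k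
      rcases hs with hs | hs
      · exact integrable_slice le_rfl hs m
      · exact integrable_slice le_top hs m
    · refine (modZNorm_locOp_le hγ hq hA hg₁ hg₂ f hk₀).trans (le_of_eq ?_)
      field_simp
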